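/- \textbf{Theorem (Roth's theorem over number fields).} Let $K$ be a number field with set of places $M_K$. For $x\in K$ put $|x|_v=|\sigma(x)|^{d_v/[K:\mathbb{Q}]}$ if $v$ is the archimedean place of an embedding $\sigma:K\hookrightarrow\mathbb{C}$, where $d_v=1$ if $v$ is real and $d_v=2$ if $v$ is complex, and $|x|_v=\bigl(N(\mathfrak p)^{-\mathrm{ord}_{\mathfrak p}(x)}\bigr)^{1/[K:\mathbb{Q}]}$ (with $|0|_v=0$) if $v$ is the place of a non-zero prime $\mathfrak p$ of $\mathcal{O}_K$, $N(\mathfrak p)$ being the absolute norm of $\mathfrak p$. Let $H(x)=\prod_{v\in M_K}\max\{1,|x|_v\}$ be the Weil height of $x\in K$. Let $S\subset M_K$ be a finite set of places and, for each $v\in S$, fix any extension of $|\cdot|_v$ to an absolute value on the algebraic closure $\bar K$, again denoted by $|\cdot|_v$. Let $\alpha\in\bar K$ and $\varepsilon>0$. Then there are only finitely many $\beta\in K$ such that $$\prod_{v\in S}\min(1,|\beta-\alpha|_v)<\frac{1}{H(\beta)^{2+\varepsilon}}.$$ -/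

import Mathlib

namespace Roth

open NumberField

/-- The set `M_K` of places of a number field: the archimedean places (complex embeddings up to
conjugation) together with the non-archimedean places (non-zero primes of the ring of integers). -/
abbrev Place (K : Type*) [Field K] [NumberField K] : Type _ :=
  InfinitePlace K ⊕ FinitePlace K

variable {K : Type*} [Field K] [NumberField K]

/-- The normalized absolute value `|x|_v`. It is `|σ x| ^ (d_v / [K : ℚ])` at an archimedean place,
with `σ` a corresponding embedding and `d_v = 1` or `2` as the place is real or complex, and
`(N 𝔭 ^ (-ord_𝔭 x)) ^ (1 / [K : ℚ])` at the place of a prime `𝔭`. -/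
noncomputable def normAbs : Place K → K → ℝ
  | .inl v, x => v x ^ ((v.mult : ℝ) / (Module.finrank ℚ K : ℝ))
  | .inr v, x => v x ^ (1 / (Module.finrank ℚ K : ℝ))

/-- The Weil height `H(x) = ∏_{v ∈ M_K} max (1, |x|_v)`. -/
noncomputable def height (x : K) : ℝ :=
  ∏ᶠ v : Place K, max 1 (normAbs v x)

/-- All but finitely many factors of the product defining the height are `1`. -/
theorem height_finite_mulSupport (x : K) :
    (Function.mulSupport fun v : Place K => max 1 (normAbs v x)).Finite := by
  rcases eq_or_ne x 0 with rfl | hx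
  · have hd : (Module.finrank ℚ K : ℝ) ≠ 0 := by
      exact_mod_cast (Module.finrank_pos (R := ℚ) (M := K)).ne'
    convert Set.finite_empty
    ext v
    rcases v with v | v
    · have : ((v.mult : ℝ) / (Module.finrank ℚ K : ℝ)) ≠ 0 :=
        div_ne_zero (by exact_mod_cast v.mult_ne_zero) hd
      simp [normAbs, Real.zero_rpow this]
    · have : (Module.finrank ℚ K : ℝ)⁻¹ ≠ 0 := inv_ne_zero hd
      simp [normAbs, Real.zero_rpow this]
  · have h := FinitePlace.hasFiniteMulSupport (K := K) hx
    refine ((Set.finite_range (Sum.inl : InfinitePlace K → Place K)).union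
      (Set.Finite.image Sum.inr h)).subset ?_
    rintro (v | v) hv
    · exact Or.inl ⟨v, rfl⟩
    · refine Or.inr ⟨v, ?_, rfl⟩
      intro h1
      apply hv
      have h2 : v x = 1 := h1
      simp [normAbs, h2]

/-- `w` is an extension to `L` of the normalized absolute value `|·|_v` of `K`. -/
def Extends {L : Type*} [Field L] [Algebra K L] (w : AbsoluteValue L ℝ) (v : Place K) : Prop :=
  ∀ x : K, w (algebraMap K L x) = normAbs v x

end Roth

/-!
Suppose infinitely many `β` violate the bound. A pigeonhole argument on the exponents
`-log |β - α|_v / log H(β)` reduces to infinitely many `β` with `|β - α|_v ≤ H(β) ^ (-κ_v)` for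
fixed `κ_v ≥ 0` whose sum exceeds `2`. Choose `m` of them with rapidly increasing heights. Siegel's
lemma gives a polynomial in `m` variables with small coefficients and large index at `(α, …, α)`:
the vanishing conditions are few because, by a Chernoff bound, a lattice point of a box seldom has
normalized coordinate sum far below its mean `m / 2`. Roth's lemma, proved by induction on `m`
through generalized Wronskians, shows that the index of this polynomial at `(β₁, …, βₘ)` is small,
so some Hasse derivative of low order does not vanish there. At the places of `S` its value is small
because each `βᵢ` is close to `α`, at the others it is bounded by the heights, and the two estimates
together contradict the product formula.
-/

namespace Roth

section Taylor

open MvPolynomial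

variable {σ R A B : Type*}

section CommSemiring

variable [CommSemiring R] [CommSemiring A] [CommSemiring B] [Algebra R A] [Algebra R B]

/-- The Taylor expansion `P(X + a)` of `P` at the point `a`, the several-variable analogue of
`Polynomial.taylor`. The coordinates of `a` may lie in an algebra over the ring of coefficients. -/
noncomputable def taylor (a : σ → A) : MvPolynomial σ R →ₐ[R] MvPolynomial σ A :=
  aeval fun j => X j + C (a j)

@[simp]
theorem taylor_X (a : σ → A) (j : σ) : taylor (R := R) a (X j) = X j + C (a j) := by
  simp [taylor]

theorem taylor_C (a : σ → A) (r : R) : taylor (R := R) a (C r) = C (algebraMap R A r) := by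
  rw [taylor, aeval_C, IsScalarTower.algebraMap_apply R A (MvPolynomial σ A), algebraMap_eq]

theorem map_taylor (a : σ → A) (φ : A →ₐ[R] B) (P : MvPolynomial σ R) :
    map (φ : A →+* B) (taylor a P) = taylor (fun j => φ (a j)) P := by
  have h : (mapAlgHom φ).comp (taylor (R := R) a) = taylor (R := R) fun j => φ (a j) :=
    algHom_ext fun j => by simp [mapAlgHom_apply]
  exact DFunLike.congr_fun h P

theorem taylor_taylor (a b : σ → A) (P : MvPolynomial σ R) :
    taylor b (taylor a P) = taylor (fun j => b j + a j) P := by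
  have h : ((taylor (R := A) b).restrictScalars R).comp (taylor (R := R) a) =
      taylor (R := R) fun j => b j + a j :=
    algHom_ext fun j => by simp [add_assoc]
  exact DFunLike.congr_fun h P

theorem aeval_taylor (a b : σ → A) (P : MvPolynomial σ R) :
    aeval b (taylor a P) = aeval (fun j => b j + a j) P := by
  have h : ((aeval (R := A) b).restrictScalars R).comp (taylor (R := R) a) =
      aeval (R := R) fun j => b j + a j :=
    algHom_ext fun j => by simp
  exact DFunLike.congr_fun h P

/-- The Hasse derivative of multi-order `I`, that is, the iterated partial derivative of order `I`
divided by `I!`, the several-variable analogue of `Polynomial.hasseDeriv`. It is encoded as the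
coefficient of `Y ^ I` in `P(X + Y)`. -/
noncomputable def hasseDeriv (I : σ →₀ ℕ) (P : MvPolynomial σ R) : MvPolynomial σ R :=
  coeff I (taylor (A := MvPolynomial σ R) X P)

theorem hasseDeriv_sum {ι : Type*} (I : σ →₀ ℕ) (s : Finset ι) (P : ι → MvPolynomial σ R) :
    hasseDeriv I (∑ i ∈ s, P i) = ∑ i ∈ s, hasseDeriv I (P i) := by
  simp only [hasseDeriv, map_sum, coeff_sum]

theorem hasseDeriv_C_mul (I : σ →₀ ℕ) (r : R) (P : MvPolynomial σ R) :
    hasseDeriv I (C r * P) = C r * hasseDeriv I P := by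
  simp only [hasseDeriv, map_mul, taylor_C, algebraMap_eq, coeff_C_mul]

theorem hasseDeriv_map {S : Type*} [CommSemiring S] (I : σ →₀ ℕ) (f : R →+* S)
    (P : MvPolynomial σ R) :
    hasseDeriv I (map f P) = map f (hasseDeriv I P) := by
  have h : (taylor X : _ →ₐ[S] MvPolynomial σ (MvPolynomial σ S)).toRingHom.comp (map f) =
      (map (map f)).comp (taylor X : _ →ₐ[R] MvPolynomial σ (MvPolynomial σ R)).toRingHom :=
    ringHom_ext (fun r => by simp) fun j => by simp
  rw [hasseDeriv, hasseDeriv, ← coeff_map]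
  exact congrArg (coeff I) (DFunLike.congr_fun h P)

theorem hasseDeriv_taylor (I : σ →₀ ℕ) (a : σ → A) (P : MvPolynomial σ R) :
    hasseDeriv I (taylor a P) = taylor a (hasseDeriv I P) := by
  have h : taylor (A := MvPolynomial σ A) X (taylor a P) =
      map (taylor (R := R) a : MvPolynomial σ R →+* MvPolynomial σ A)
        (taylor (A := MvPolynomial σ R) X P) := by
    have hcomp : ((taylor (R := A) (A := MvPolynomial σ A) X).restrictScalars R).comp
        (taylor (R := R) a) = taylor (R := R) fun j => taylor a (X j : MvPolynomial σ R) :=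
      algHom_ext fun j => by simp [add_assoc, algebraMap_eq]
    rw [map_taylor]
    exact DFunLike.congr_fun hcomp P
  rw [hasseDeriv, h, coeff_map]
  rfl

theorem aeval_hasseDeriv (I : σ →₀ ℕ) (a : σ → A) (P : MvPolynomial σ R) :
    aeval a (hasseDeriv I P) = coeff I (taylor a P) := by
  rw [hasseDeriv, ← AlgHom.coe_toRingHom, ← coeff_map]
  exact congrArg (coeff I) ((map_taylor _ _ P).trans (by simp))

section Fintype

variable [Fintype σ]

/-- The product of binomial coefficients `∏ j, (e j).choose (I j)` attached to two exponents. -/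
def multiBinom (e I : σ →₀ ℕ) : ℕ := ∏ j, (e j).choose (I j)

theorem multiBinom_eq_zero {e I : σ →₀ ℕ} (h : ¬ I ≤ e) : multiBinom e I = 0 := by
  rw [Finsupp.le_def, not_forall] at h
  obtain ⟨j, hj⟩ := h
  exact Finset.prod_eq_zero (Finset.mem_univ j) (Nat.choose_eq_zero_of_lt (not_le.1 hj))

theorem multiBinom_le_two_pow (e I : σ →₀ ℕ) : multiBinom e I ≤ 2 ^ ∑ j, e j := by
  rw [← Finset.prod_pow_eq_pow_sum]
  exact Finset.prod_le_prod' fun j _ => Nat.choose_le_two_pow _ _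

theorem prod_X_add_C_pow [DecidableEq σ] (a : σ → A) (e : σ →₀ ℕ) :
    ∏ j, (X j + C (a j)) ^ e j = ∑ p ∈ Fintype.piFinset fun j => Finset.range (e j + 1),
      monomial (Finsupp.equivFunOnFinite.symm p)
        (∏ j, a j ^ (e j - p j) * ((e j).choose (p j) : A)) := by
  simp_rw [add_pow]
  rw [Finset.prod_univ_sum]
  refine Finset.sum_congr rfl fun p _ => ?_
  rw [monomial_eq, Finsupp.prod_fintype _ _ (by simp), map_prod, ← Finset.prod_mul_distrib]
  refine Finset.prod_congr rfl fun j _ => ?_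
  simp only [map_mul, map_pow, map_natCast, Finsupp.equivFunOnFinite_symm_apply_apply]
  ring

theorem coeff_prod_X_add_C_pow (a : σ → A) (e J : σ →₀ ℕ) :
    coeff J (∏ j, (X j + C (a j)) ^ e j) = (multiBinom e J : A) * ∏ j, a j ^ (e j - J j) := by
  classical
  simp_rw [prod_X_add_C_pow, coeff_sum, coeff_monomial, Equiv.symm_apply_eq, Finset.sum_ite_eq']
  rw [multiBinom, Nat.cast_prod, mul_comm, ← Finset.prod_mul_distrib]
  refine ite_eq_left_iff.2 fun hJ => (?_ : _ = _)
  obtain ⟨j, hj⟩ : ∃ j, e j < J j := by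
    simpa [Fintype.mem_piFinset, Nat.lt_succ_iff] using hJ
  exact (Finset.prod_eq_zero (Finset.mem_univ j) (by simp [Nat.choose_eq_zero_of_lt hj])).symm

theorem taylor_monomial (a : σ → A) (e : σ →₀ ℕ) (r : R) :
    taylor a (monomial e r) = C (algebraMap R A r) * ∏ j, (X j + C (a j)) ^ e j := by
  rw [taylor, aeval_monomial, Finsupp.prod_fintype _ _ (by simp)]
  rfl

theorem coeff_taylor_monomial (a : σ → A) (e J : σ →₀ ℕ) (r : R) :
    coeff J (taylor a (monomial e r)) =
      algebraMap R A r * ((multiBinom e J : A) * ∏ j, a j ^ (e j - J j)) := by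
  rw [taylor_monomial, coeff_C_mul, coeff_prod_X_add_C_pow]

theorem coeff_taylor (a : σ → A) (P : MvPolynomial σ R) (J : σ →₀ ℕ) :
    coeff J (taylor a P) = ∑ e ∈ P.support,
      algebraMap R A (coeff e P) * ((multiBinom e J : A) * ∏ j, a j ^ (e j - J j)) := by
  conv_lhs => rw [P.as_sum]
  rw [map_sum, coeff_sum]
  exact Finset.sum_congr rfl fun e _ => coeff_taylor_monomial a e J _

theorem hasseDeriv_eq_sum (I : σ →₀ ℕ) (P : MvPolynomial σ R) :
    hasseDeriv I P = ∑ e ∈ P.support, monomial (e - I) (coeff e P * multiBinom e I) := by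
  rw [hasseDeriv, coeff_taylor]
  refine Finset.sum_congr rfl fun e _ => ?_
  rw [monomial_eq, Finsupp.prod_fintype _ _ (by simp), C_mul, ← mul_assoc]
  simp [algebraMap_eq]

theorem coeff_hasseDeriv (I e : σ →₀ ℕ) (P : MvPolynomial σ R) :
    coeff e (hasseDeriv I P) = multiBinom (e + I) I * coeff (e + I) P := by
  classical
  simp_rw [hasseDeriv_eq_sum, coeff_sum, coeff_monomial]
  rw [Finset.sum_eq_single (e + I)]
  · simp [mul_comm]
  · intro f _ hf
    refine ite_eq_right_iff.2 fun hfe => ?_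
    rw [multiBinom_eq_zero, Nat.cast_zero, mul_zero]
    exact fun hI => hf (by rw [← hfe, tsub_add_cancel_of_le hI])
  · intro h
    simp [notMem_support_iff.1 h]

end Fintype

theorem degreeOf_hasseDeriv_le [Finite σ] (P : MvPolynomial σ R) (I : σ →₀ ℕ) (j : σ) :
    degreeOf j (hasseDeriv I P) ≤ degreeOf j P := by
  cases nonempty_fintype σ
  refine degreeOf_le_iff.2 fun e he => ?_
  rw [mem_support_iff, coeff_hasseDeriv] at he
  exact (Nat.le_add_right _ _).trans
    (degreeOf_le_iff.1 le_rfl (e + I) (mem_support_iff.2 (right_ne_zero_of_mul he)))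

theorem degreeOf_taylor_le [Finite σ] (P : MvPolynomial σ R) (a : σ → A) (j : σ) :
    degreeOf j (taylor a P) ≤ degreeOf j P := by
  cases nonempty_fintype σ
  refine degreeOf_le_iff.2 fun e he => ?_
  rw [mem_support_iff, coeff_taylor] at he
  obtain ⟨f, hf, hne⟩ := Finset.exists_ne_zero_of_sum_ne_zero he
  have hef : e ≤ f := by
    by_contra h
    simp [multiBinom_eq_zero h] at hne
  exact (hef j).trans (degreeOf_le_iff.1 le_rfl f hf)

theorem sum_le_sum_of_degreeOf_le [Fintype σ] {d : σ → ℕ} {P : MvPolynomial σ R}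
    (hd : ∀ j, degreeOf j P ≤ d j) {e : σ →₀ ℕ} (he : e ∈ P.support) : ∑ j, e j ≤ ∑ j, d j :=
  Finset.sum_le_sum fun j _ => degreeOf_le_iff.1 (hd j) e he

end CommSemiring

section CommRing

variable [CommRing R] [CommRing A] [Algebra R A]

theorem taylor_injective [FaithfulSMul R A] (a : σ → A) :
    Function.Injective (taylor (R := R) a) := by
  have h (P : MvPolynomial σ R) :
      taylor (fun j => -a j) (taylor a P) = map (algebraMap R A) P := by
    have hmap : taylor 0 = mapAlgHom (σ := σ) (Algebra.ofId R A) := algHom_ext fun j => by simp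
    rw [taylor_taylor]
    simpa [← Pi.zero_def, -map_eq_zero] using DFunLike.congr_fun hmap P
  exact fun P Q hPQ => map_injective _ (FaithfulSMul.algebraMap_injective R A) <| by
    rw [← h, ← h, hPQ]

theorem aeval_eq_sum_coeff_taylor [Fintype σ] (a b : σ → A) (P : MvPolynomial σ R) :
    aeval b P = ∑ e ∈ (taylor a P).support, coeff e (taylor a P) * ∏ j, (b j - a j) ^ e j := by
  have h : (fun j => b j - a j + a j) = b := funext fun j => sub_add_cancel _ _
  conv_lhs => rw [← h, ← aeval_taylor]
  rw [aeval_def, eval₂_eq']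
  rfl

end CommRing

end Taylor

section Order

open MvPolynomial

variable {σ R : Type*} [CommSemiring R]

/-- The monomials of `P` all have `ω`-weight at least `t`. For `ω = indexWeight d` and the
polynomial `taylor a P`, this says that the index of `P` at `a` with respect to `d` is at
least `t`. -/
def OrderGE (ω : (σ →₀ ℕ) →+ ℝ) (t : ℝ) (P : MvPolynomial σ R) : Prop :=
  ∀ e, coeff e P ≠ 0 → t ≤ ω e

namespace OrderGE

variable {ω : (σ →₀ ℕ) →+ ℝ} {ι : Type*}

theorem mono {s t : ℝ} {P : MvPolynomial σ R} (h : OrderGE ω t P) (hst : s ≤ t) :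
    OrderGE ω s P := fun e he => hst.trans (h e he)

theorem sum {s : Finset ι} {t : ℝ} {P : ι → MvPolynomial σ R} (h : ∀ i ∈ s, OrderGE ω t (P i)) :
    OrderGE ω t (∑ i ∈ s, P i) := by
  intro e he
  rw [coeff_sum] at he
  obtain ⟨i, hi, hne⟩ := Finset.exists_ne_zero_of_sum_ne_zero he
  exact h i hi e hne

theorem mul {s t : ℝ} {P Q : MvPolynomial σ R} (hP : OrderGE ω s P) (hQ : OrderGE ω t Q) :
    OrderGE ω (s + t) (P * Q) := by
  classical
  intro e he
  rw [coeff_mul] at he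
  obtain ⟨x, hx, hne⟩ := Finset.exists_ne_zero_of_sum_ne_zero he
  rw [← Finset.HasAntidiagonal.mem_antidiagonal.1 hx, map_add]
  exact add_le_add (hP _ (left_ne_zero_of_mul hne)) (hQ _ (right_ne_zero_of_mul hne))

theorem one : OrderGE ω 0 (1 : MvPolynomial σ R) := by
  classical
  intro e he
  obtain rfl : 0 = e := by
    by_contra h
    simp [coeff_one, h] at he
  simp

theorem prod {s : Finset ι} {t : ι → ℝ} {P : ι → MvPolynomial σ R}
    (h : ∀ i ∈ s, OrderGE ω (t i) (P i)) : OrderGE ω (∑ i ∈ s, t i) (∏ i ∈ s, P i) := by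
  classical
  induction s using Finset.induction_on with
  | empty => simpa using OrderGE.one
  | insert i s hi ih =>
    rw [Finset.sum_insert hi, Finset.prod_insert hi]
    exact (h i (Finset.mem_insert_self i s)).mul
      (ih fun j hj => h j (Finset.mem_insert_of_mem hj))

theorem det {R : Type*} [CommRing R] [Fintype ι] [DecidableEq ι] {t : ι → ℝ}
    {M : Matrix ι ι (MvPolynomial σ R)} (h : ∀ i j, OrderGE ω (t j) (M i j)) :
    OrderGE ω (∑ j, t j) M.det := by
  rw [Matrix.det_apply]
  refine OrderGE.sum fun π _ e he => ?_
  refine OrderGE.prod (fun i _ => h (π i) i) e fun h0 => he ?_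
  rw [Units.smul_def, coeff_smul, h0, smul_zero]

theorem hasseDeriv [Finite σ] {t : ℝ} {P : MvPolynomial σ R} (h : OrderGE ω t P) (I : σ →₀ ℕ) :
    OrderGE ω (t - ω I) (hasseDeriv I P) := by
  cases nonempty_fintype σ
  intro e he
  rw [coeff_hasseDeriv] at he
  rw [sub_le_iff_le_add, ← map_add]
  exact h _ (right_ne_zero_of_mul he)

end OrderGE

/-- The weight `∑ j, e j / d j` of an exponent `e`, which defines the index of a polynomial with
respect to the multidegree `d`. -/
noncomputable def indexWeight [Fintype σ] (d : σ → ℕ) : (σ →₀ ℕ) →+ ℝ where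
  toFun e := ∑ j, (e j : ℝ) / d j
  map_zero' := by simp
  map_add' e f := by simp [add_div, Finset.sum_add_distrib]

theorem indexWeight_apply [Fintype σ] (d : σ → ℕ) (e : σ →₀ ℕ) :
    indexWeight d e = ∑ j, (e j : ℝ) / d j := rfl

theorem indexWeight_nonneg [Fintype σ] (d : σ → ℕ) (e : σ →₀ ℕ) : 0 ≤ indexWeight d e :=
  Finset.sum_nonneg fun _ _ => by positivity

end Order

section Norm

open MvPolynomial

variable {σ R : Type*}

section CommSemiring

variable [CommSemiring R]

/-- The `ℓ¹` norm of a polynomial with respect to an absolute value on its coefficients. -/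
noncomputable def l1Norm (v : AbsoluteValue R ℝ) (P : MvPolynomial σ R) : ℝ :=
  ∑ e ∈ P.support, v (coeff e P)

variable (v : AbsoluteValue R ℝ)

theorem l1Norm_eq_sum {P : MvPolynomial σ R} {s : Finset (σ →₀ ℕ)} (h : P.support ⊆ s) :
    l1Norm v P = ∑ e ∈ s, v (coeff e P) :=
  Finset.sum_subset h fun e _ he => by rw [notMem_support_iff.1 he, map_zero]

theorem l1Norm_nonneg (P : MvPolynomial σ R) : 0 ≤ l1Norm v P :=
  Finset.sum_nonneg fun _ _ => v.nonneg _

@[simp]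
theorem l1Norm_monomial (e : σ →₀ ℕ) (r : R) : l1Norm v (monomial e r) = v r := by
  classical
  rw [l1Norm_eq_sum v support_monomial_subset, Finset.sum_singleton, coeff_monomial, if_pos rfl]

@[simp]
theorem l1Norm_C (r : R) : l1Norm v (C r : MvPolynomial σ R) = v r := l1Norm_monomial v 0 r

theorem l1Norm_add_le (P Q : MvPolynomial σ R) : l1Norm v (P + Q) ≤ l1Norm v P + l1Norm v Q := by
  classical
  rw [l1Norm_eq_sum v (support_add (p := P) (q := Q)),
    l1Norm_eq_sum v (Finset.subset_union_left (s₁ := P.support) (s₂ := Q.support)),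
    l1Norm_eq_sum v (Finset.subset_union_right (s₁ := P.support) (s₂ := Q.support)),
    ← Finset.sum_add_distrib]
  exact Finset.sum_le_sum fun e _ => by
    rw [coeff_add]
    exact v.add_le _ _

theorem l1Norm_sum_le {ι : Type*} (s : Finset ι) (P : ι → MvPolynomial σ R) :
    l1Norm v (∑ i ∈ s, P i) ≤ ∑ i ∈ s, l1Norm v (P i) :=
  Finset.le_sum_of_subadditive _ (by simp [l1Norm]) (l1Norm_add_le v) s P

theorem l1Norm_mul_le (P Q : MvPolynomial σ R) : l1Norm v (P * Q) ≤ l1Norm v P * l1Norm v Q := by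
  have h : P * Q = ∑ e ∈ P.support, ∑ f ∈ Q.support,
      monomial (e + f) (coeff e P * coeff f Q) := by
    conv_lhs => rw [P.as_sum, Q.as_sum]
    simp_rw [Finset.sum_mul_sum, monomial_mul]
  rw [h, l1Norm.eq_1 v P, l1Norm.eq_1 v Q, Finset.sum_mul_sum]
  refine (l1Norm_sum_le v _ _).trans (Finset.sum_le_sum fun e _ => ?_)
  refine (l1Norm_sum_le v _ _).trans (Finset.sum_le_sum fun f _ => ?_)
  rw [l1Norm_monomial, map_mul]

theorem abv_coeff_le_l1Norm (P : MvPolynomial σ R) (e : σ →₀ ℕ) : v (coeff e P) ≤ l1Norm v P := by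
  by_cases h : e ∈ P.support
  · exact Finset.single_le_sum (f := fun e => v (coeff e P)) (fun _ _ => v.nonneg _) h
  · rw [notMem_support_iff.1 h, map_zero]
    exact l1Norm_nonneg v P

theorem l1Norm_prod_le [IsDomain R] {ι : Type*} (s : Finset ι) (P : ι → MvPolynomial σ R) :
    l1Norm v (∏ i ∈ s, P i) ≤ ∏ i ∈ s, l1Norm v (P i) := by
  classical
  induction s using Finset.induction_on with
  | empty => simpa using (l1Norm_C (σ := σ) v 1).le
  | insert i s hi ih =>
    rw [Finset.prod_insert hi, Finset.prod_insert hi]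
    exact (l1Norm_mul_le v _ _).trans (mul_le_mul_of_nonneg_left ih (l1Norm_nonneg v _))

theorem l1Norm_pow_le [IsDomain R] (P : MvPolynomial σ R) (n : ℕ) :
    l1Norm v (P ^ n) ≤ l1Norm v P ^ n := by
  simpa using l1Norm_prod_le v (Finset.range n) fun _ => P

variable [Fintype σ] {d : σ → ℕ} {P : MvPolynomial σ R}

theorem l1Norm_hasseDeriv_le (hd : ∀ j, degreeOf j P ≤ d j) (I : σ →₀ ℕ) :
    l1Norm v (hasseDeriv I P) ≤ 2 ^ (∑ j, d j) * l1Norm v P := by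
  rw [hasseDeriv_eq_sum, l1Norm.eq_1 v P, Finset.mul_sum]
  refine (l1Norm_sum_le _ _ _).trans (Finset.sum_le_sum fun e he => ?_)
  have hbinom : multiBinom e I ≤ 2 ^ ∑ j, d j := (multiBinom_le_two_pow e I).trans
    (Nat.pow_le_pow_right two_pos (sum_le_sum_of_degreeOf_le hd he))
  rw [l1Norm_monomial, map_mul, mul_comm]
  exact mul_le_mul_of_nonneg_right
    ((v.apply_nat_le_self _).trans (mod_cast hbinom)) (v.nonneg _)

theorem l1Norm_taylor_le {A : Type*} [CommSemiring A] [IsDomain A] [Algebra R A]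
    {w : AbsoluteValue A ℝ} (hvw : ∀ r, w (algebraMap R A r) ≤ v r)
    (hd : ∀ j, degreeOf j P ≤ d j) {a : σ → A} {B : ℝ} (hB1 : 1 ≤ B) (hB : ∀ j, 1 + w (a j) ≤ B) :
    l1Norm w (taylor a P) ≤ l1Norm v P * B ^ ∑ j, d j := by
  have hlin (j : σ) : l1Norm w (X j + C (a j)) ≤ B := by
    refine (l1Norm_add_le _ _ _).trans (le_trans ?_ (hB j))
    rw [X, l1Norm_monomial, l1Norm_C, map_one]
  have hprod (e : σ →₀ ℕ) (he : e ∈ P.support) :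
      l1Norm w (∏ j, (X j + C (a j)) ^ e j) ≤ B ^ ∑ j, d j :=
    calc l1Norm w (∏ j, (X j + C (a j)) ^ e j)
        ≤ ∏ j, l1Norm w ((X j + C (a j)) ^ e j) := l1Norm_prod_le _ _ _
      _ ≤ ∏ j, B ^ e j := Finset.prod_le_prod (fun _ _ => l1Norm_nonneg _ _) fun j _ =>
          (l1Norm_pow_le _ _ _).trans (pow_le_pow_left₀ (l1Norm_nonneg _ _) (hlin j) _)
      _ = B ^ ∑ j, e j := Finset.prod_pow_eq_pow_sum _ _ _
      _ ≤ B ^ ∑ j, d j := pow_le_pow_right₀ hB1 (sum_le_sum_of_degreeOf_le hd he)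
  conv_lhs => rw [P.as_sum]
  rw [map_sum, l1Norm.eq_1 v P, Finset.sum_mul]
  refine (l1Norm_sum_le _ _ _).trans (Finset.sum_le_sum fun e he => ?_)
  rw [taylor_monomial]
  refine (l1Norm_mul_le _ _ _).trans ?_
  rw [l1Norm_C]
  exact mul_le_mul (hvw _) (hprod e he) (l1Norm_nonneg _ _) (v.nonneg _)

end CommSemiring

theorem l1Norm_det_le [CommRing R] [IsDomain R] (v : AbsoluteValue R ℝ) {ι : Type*} [Fintype ι]
    [DecidableEq ι] (M : Matrix ι ι (MvPolynomial σ R)) {B : ℝ} (hB : ∀ i j, l1Norm v (M i j) ≤ B) :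
    l1Norm v M.det ≤ (Fintype.card ι).factorial * B ^ Fintype.card ι := by
  have hterm (π : Equiv.Perm ι) :
      l1Norm v (Equiv.Perm.sign π • ∏ i, M (π i) i) ≤ B ^ Fintype.card ι := by
    have hsign : Equiv.Perm.sign π • ∏ i, M (π i) i =
        C ((Equiv.Perm.sign π : ℤ) : R) * ∏ i, M (π i) i := by
      rw [Units.smul_def, zsmul_eq_mul, map_intCast]
    have hunit : v ((Equiv.Perm.sign π : ℤ) : R) = 1 := by
      rcases Int.units_eq_one_or (Equiv.Perm.sign π) with h | h <;> simp [h]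
    calc l1Norm v (Equiv.Perm.sign π • ∏ i, M (π i) i) ≤ l1Norm v (∏ i, M (π i) i) := by
          rw [hsign]
          refine (l1Norm_mul_le _ _ _).trans_eq ?_
          rw [l1Norm_C, hunit, one_mul]
      _ ≤ ∏ i, l1Norm v (M (π i) i) := l1Norm_prod_le _ _ _
      _ ≤ ∏ _i : ι, B := Finset.prod_le_prod (fun _ _ => l1Norm_nonneg _ _) fun i _ => hB _ _
      _ = B ^ Fintype.card ι := by rw [Finset.prod_const, Finset.card_univ]
  rw [Matrix.det_apply]
  refine (l1Norm_sum_le _ _ _).trans ?_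
  refine (Finset.sum_le_card_nsmul _ _ _ fun π _ => hterm π).trans_eq ?_
  rw [Finset.card_univ, Fintype.card_perm, nsmul_eq_mul]

/-- The usual absolute value on `ℤ`, with real values. -/
noncomputable def intAbv : AbsoluteValue ℤ ℝ :=
  (AbsoluteValue.abs : AbsoluteValue ℝ ℝ).comp (f := Int.castRingHom ℝ) Int.cast_injective

@[simp]
theorem intAbv_apply (n : ℤ) : intAbv n = |(n : ℝ)| := rfl

theorem abv_intCast_le_intAbv {A : Type*} [CommRing A] (w : AbsoluteValue A ℝ)
    (n : ℤ) : w (n : A) ≤ intAbv n := by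
  rw [← w.apply_natAbs_eq]
  refine (w.apply_nat_le_self _).trans_eq ?_
  simp [Nat.cast_natAbs]

theorem one_le_l1Norm_intAbv {P : MvPolynomial σ ℤ} (h : P ≠ 0) : 1 ≤ l1Norm intAbv P := by
  obtain ⟨e, he⟩ := ne_zero_iff.1 h
  have hcoeff : 1 ≤ intAbv (coeff e P) := by
    rw [intAbv_apply]
    exact_mod_cast Int.one_le_abs he
  exact hcoeff.trans (abv_coeff_le_l1Norm _ _ e)

end Norm

section Wronskian

open MvPolynomial
open scoped MonomialOrder

section LeadingExponents

variable {σ F : Type*} [Field F] (m : MonomialOrder σ)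

theorem exists_degree_sub_smul_lt {f g : MvPolynomial σ F} (hg : g ≠ 0)
    (h : m.degree f = m.degree g) :
    ∃ c : F, f - c • g ≠ 0 → m.degree (f - c • g) ≺[m] m.degree f := by
  refine ⟨m.leadingCoeff f / m.leadingCoeff g, fun h0 => lt_of_le_of_ne ?_ fun heq => ?_⟩
  · refine m.degree_sub_le.trans (sup_le le_rfl ?_)
    rw [h]
    exact m.degree_smul_le
  · have hcoeff : coeff (m.degree f) (f - (m.leadingCoeff f / m.leadingCoeff g) • g) = 0 := by
      rw [coeff_sub, coeff_smul, h, ← MonomialOrder.leadingCoeff, ← h, ← MonomialOrder.leadingCoeff,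
        smul_eq_mul, div_mul_cancel₀ _ (m.leadingCoeff_ne_zero_iff.2 hg), sub_self]
    rw [← m.toSyn.injective heq] at hcoeff
    exact m.leadingCoeff_ne_zero_iff.2 h0 hcoeff

theorem mem_span_range_of_degree {ι : Type*} {V : Submodule F (MvPolynomial σ F)}
    {g : ι → MvPolynomial σ F} (hgV : ∀ i, g i ∈ V) (hg : ∀ i, g i ≠ 0)
    (hV : ∀ f ∈ V, f ≠ 0 → ∃ i, m.degree f = m.degree (g i)) :
    V ≤ Submodule.span F (Set.range g) := by
  intro f hf
  induction hd : m.toSyn (m.degree f) using WellFoundedLT.induction generalizing f with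
  | ind d ih =>
    by_cases hf0 : f = 0
    · exact hf0 ▸ Submodule.zero_mem _
    obtain ⟨i, hi⟩ := hV f hf hf0
    obtain ⟨c, hc⟩ := exists_degree_sub_smul_lt m (hg i) hi
    have hmem : f - c • g i ∈ Submodule.span F (Set.range g) := by
      by_cases h0 : f - c • g i = 0
      · exact h0 ▸ Submodule.zero_mem _
      · exact ih _ (hd ▸ hc h0) (V.sub_mem hf (V.smul_mem c (hgV i))) rfl
    have hsmul : c • g i ∈ Submodule.span F (Set.range g) :=
      Submodule.smul_mem _ c (Submodule.subset_span (Set.mem_range_self i))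
    exact (Submodule.sub_mem_iff_left _ hsmul).1 hmem

theorem exists_injective_degree {ι : Type*} [Finite ι] {f : ι → MvPolynomial σ F}
    (hf : LinearIndependent F f) :
    ∃ g : ι → MvPolynomial σ F, (∀ i, g i ∈ Submodule.span F (Set.range f)) ∧ (∀ i, g i ≠ 0) ∧
      Function.Injective fun i => m.degree (g i) := by
  classical
  let D : Set (σ →₀ ℕ) := {e | ∃ g ∈ Submodule.span F (Set.range f), g ≠ 0 ∧ e = m.degree g}
  choose G hGV hG0 hGdeg using fun e : D => e.2
  have hspan : Set.range f ≤ Submodule.span F (Set.range G) :=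
    Submodule.subset_span.trans <| mem_span_range_of_degree m hGV hG0
      fun g hgV hg0 => ⟨_, hGdeg ⟨_, g, hgV, hg0, rfl⟩⟩
  obtain ⟨φ⟩ : Nonempty (ι ↪ D) := by
    cases nonempty_fintype ι
    cases finite_or_infinite D
    · cases nonempty_fintype D
      exact Function.Embedding.nonempty_of_card_le <|
        (linearIndependent_le_span_aux' f hf (Set.range G) hspan).trans (Fintype.card_range_le G)
    · exact ⟨(Fintype.equivFin ι).toEmbedding.trans
        (Fin.valEmbedding.trans (Infinite.natEmbedding D))⟩
  exact ⟨fun i => G (φ i), fun i => hGV _, fun i => hG0 _, fun i j hij => φ.injective <|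
    Subtype.ext <| (hGdeg _).trans <| hij.trans (hGdeg _).symm⟩

theorem coeff_prod_of_degree_le {R ι : Type*} [CommSemiring R] {s : Finset ι}
    {f : ι → MvPolynomial σ R} {e : ι → σ →₀ ℕ} (h : ∀ i ∈ s, m.degree (f i) ≼[m] e i) :
    coeff (∑ i ∈ s, e i) (∏ i ∈ s, f i) = ∏ i ∈ s, coeff (e i) (f i) := by
  classical
  induction s using Finset.induction_on with
  | empty => simp
  | insert i s hi ih =>
    have hs (j) (hj : j ∈ s) := h j (Finset.mem_insert_of_mem hj)
    have hprod : m.degree (∏ j ∈ s, f j) ≼[m] ∑ j ∈ s, e j := by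
      refine m.degree_prod_le.trans ?_
      simp only [map_sum]
      exact Finset.sum_le_sum hs
    rw [Finset.prod_insert hi, Finset.sum_insert hi, Finset.prod_insert hi,
      m.coeff_mul_of_add_of_degree_le (h i (Finset.mem_insert_self i s)) hprod, ih hs]

end LeadingExponents

section Binomial

variable {σ ι : Type*} [Fintype σ]

theorem mul_multiBinom (e I : σ →₀ ℕ) (x : σ) :
    e x * multiBinom e I =
      (I x + 1) * multiBinom e (I + Finsupp.single x 1) + I x * multiBinom e I := by
  classical
  have hchoose (n k : ℕ) : n * n.choose k = (k + 1) * n.choose (k + 1) + k * n.choose k := by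
    rw [mul_comm (k + 1), Nat.choose_succ_right_eq]
    rcases le_or_gt k n with hkn | hnk
    · obtain ⟨q, rfl⟩ := exists_add_of_le hkn
      rw [add_tsub_cancel_left]
      ring
    · simp [Nat.choose_eq_zero_of_lt hnk]
  have hsplit (J : σ →₀ ℕ) : multiBinom e J =
      (e x).choose (J x) * ∏ j ∈ Finset.univ.erase x, (e j).choose (J j) :=
    (Finset.mul_prod_erase _ _ (Finset.mem_univ x)).symm
  have hrest : ∏ j ∈ Finset.univ.erase x, (e j).choose ((I + Finsupp.single x 1 : σ →₀ ℕ) j) =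
      ∏ j ∈ Finset.univ.erase x, (e j).choose (I j) :=
    Finset.prod_congr rfl fun j hj => by
      rw [Finsupp.add_apply, Finsupp.single_eq_of_ne (Finset.ne_of_mem_erase hj), add_zero]
  rw [hsplit I, hsplit (I + _), hrest, Finsupp.add_apply, Finsupp.single_eq_same, ← mul_assoc,
    hchoose]
  ring

/-- The space of functions `i ↦ Q (e i)` with `Q` a polynomial of degree at most `n`, presented
as the span of the functions `i ↦ multiBinom (e i) I` for `|I| ≤ n`. -/
def binomSpan (F : Type*) [Field F] (e : ι → σ →₀ ℕ) (n : ℕ) : Submodule F (ι → F) :=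
  Submodule.span F {φ | ∃ I : σ →₀ ℕ, ∑ x, I x ≤ n ∧ φ = fun i => (multiBinom (e i) I : F)}

variable {F : Type*} [Field F]

theorem multiBinom_mem_binomSpan (e : ι → σ →₀ ℕ) {n : ℕ} {I : σ →₀ ℕ} (hI : ∑ x, I x ≤ n) :
    (fun i => (multiBinom (e i) I : F)) ∈ binomSpan F e n :=
  Submodule.subset_span ⟨I, hI, rfl⟩

theorem sub_mul_mem_binomSpan (e : ι → σ →₀ ℕ) {n : ℕ} (x : σ) (c : F) {φ : ι → F}
    (hφ : φ ∈ binomSpan F e n) : (fun i => (e i x : F) - c) * φ ∈ binomSpan F e (n + 1) := by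
  classical
  suffices h : binomSpan F e n ≤
      (binomSpan F e (n + 1)).comap (LinearMap.mulLeft F fun i => (e i x : F) - c) from h hφ
  refine Submodule.span_le.2 ?_
  rintro _ ⟨I, hI, rfl⟩
  have hsucc : ∑ y, (I + Finsupp.single x 1 : σ →₀ ℕ) y ≤ n + 1 := by
    simpa [Finset.sum_add_distrib, Finsupp.single_apply] using hI
  have hrec : (fun i => (e i x : F) - c) * (fun i => (multiBinom (e i) I : F)) =
      (I x + 1 : F) • (fun i => (multiBinom (e i) (I + Finsupp.single x 1) : F)) +
        (I x - c : F) • fun i => (multiBinom (e i) I : F) := by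
    ext i
    have hi := congrArg (Nat.cast (R := F)) (mul_multiBinom (e i) I x)
    push_cast at hi
    simp only [Pi.mul_apply, Pi.add_apply, Pi.smul_apply, smul_eq_mul]
    linear_combination hi
  rw [SetLike.mem_coe, Submodule.mem_comap, LinearMap.mulLeft_apply, hrec]
  exact Submodule.add_mem _ (Submodule.smul_mem _ _ (multiBinom_mem_binomSpan e hsucc))
    (Submodule.smul_mem _ _ (multiBinom_mem_binomSpan e (hI.trans n.le_succ)))

theorem prod_sub_mem_binomSpan {κ : Type*} (e : ι → σ →₀ ℕ) (s : Finset κ) (x : κ → σ)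
    (c : κ → F) : (∏ k ∈ s, fun i => (e i (x k) : F) - c k) ∈ binomSpan F e s.card := by
  classical
  induction s using Finset.induction_on with
  | empty =>
    rw [Finset.prod_empty]
    convert multiBinom_mem_binomSpan e (I := 0) (by simp) using 1
    ext i
    simp [multiBinom]
  | insert k s hk ih =>
    rw [Finset.prod_insert hk, Finset.card_insert_of_notMem hk]
    exact sub_mul_mem_binomSpan e _ _ ih

theorem binomSpan_eq_top [CharZero F] [Fintype ι] {e : ι → σ →₀ ℕ}
    (he : Function.Injective e) : binomSpan F e (Fintype.card ι - 1) = ⊤ := by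
  classical
  have hsingle (i : ι) : Pi.single i 1 ∈ binomSpan F e (Fintype.card ι - 1) := by
    choose x hx using fun k : {k // k ≠ i} => DFunLike.ne_iff.1 (he.ne k.2.symm)
    have hmem := prod_sub_mem_binomSpan (F := F) e Finset.univ x fun k => (e k (x k) : F)
    rw [Finset.card_univ, Fintype.card_subtype_compl, Fintype.card_subtype_eq] at hmem
    set φ : ι → F := ∏ k : {k // k ≠ i}, fun j => (e j (x k) : F) - e k (x k)
    have hφ (j : ι) : φ j = ∏ k : {k // k ≠ i}, ((e j (x k) : F) - e k (x k)) :=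
      Finset.prod_apply _ _ _
    have hφi : φ i ≠ 0 := by
      rw [hφ]
      exact Finset.prod_ne_zero_iff.2 fun k _ => sub_ne_zero.2 (Nat.cast_injective.ne (hx k))
    have hφj (j : ι) (hj : j ≠ i) : φ j = 0 := by
      rw [hφ]
      exact Finset.prod_eq_zero (Finset.mem_univ ⟨j, hj⟩) (sub_self _)
    convert Submodule.smul_mem _ (φ i)⁻¹ hmem using 1
    ext j
    rcases eq_or_ne j i with rfl | hj
    · simp [hφi]
    · simp [hj, hφj j hj]
  refine eq_top_iff.2 fun ψ _ => ?_
  rw [pi_eq_sum_univ' ψ]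
  exact Submodule.sum_mem _ fun i _ => Submodule.smul_mem _ _ (hsingle i)

theorem exists_det_multiBinom_ne_zero [CharZero F] [Fintype ι] [DecidableEq ι]
    {e : ι → σ →₀ ℕ} (he : Function.Injective e) :
    ∃ I : ι → σ →₀ ℕ, (∀ i, ∑ x, I i x ≤ Fintype.card ι - 1) ∧
      (Matrix.of fun i j => (multiBinom (e j) (I i) : F)).det ≠ 0 := by
  have hspan : Module.finrank F (binomSpan F e (Fintype.card ι - 1)) = Fintype.card ι := by
    rw [binomSpan_eq_top he, finrank_top, Module.finrank_fintype_fun_eq_card]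
  obtain ⟨φ, hφ, -, hli⟩ := Submodule.exists_fun_fin_finrank_span_eq F
    {φ : ι → F | ∃ I : σ →₀ ℕ, ∑ x, I x ≤ Fintype.card ι - 1 ∧
      φ = fun i => (multiBinom (e i) I : F)}
  choose I hI hφI using hφ
  let r : ι ≃ Fin _ := (Fintype.equivFin ι).trans (finCongr hspan.symm)
  refine ⟨fun i => I (r i), fun i => hI _, ?_⟩
  have hrows : (Matrix.of fun i j => (multiBinom (e j) (I (r i)) : F)).row = φ ∘ r :=
    funext fun i => (hφI (r i)).symm
  have hrow_li := hli.comp r r.injective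
  rw [← hrows, Matrix.linearIndependent_rows_iff_isUnit, Matrix.isUnit_iff_isUnit_det] at hrow_li
  exact hrow_li.ne_zero

end Binomial

variable {σ ι F : Type*} [Fintype σ] [Field F] [Fintype ι] [DecidableEq ι]

theorem coeff_monomial_mul_hasseDeriv (I b : σ →₀ ℕ) (P : MvPolynomial σ F) :
    coeff b (monomial I 1 * hasseDeriv I P) = multiBinom b I * coeff b P := by
  rw [coeff_monomial_mul']
  split_ifs with h
  · rw [one_mul, coeff_hasseDeriv, tsub_add_cancel_of_le h]
  · rw [multiBinom_eq_zero h, Nat.cast_zero, zero_mul]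

theorem det_hasseDeriv_ne_zero (m : MonomialOrder σ) {g : ι → MvPolynomial σ F}
    (hg : ∀ j, g j ≠ 0) {I : ι → σ →₀ ℕ}
    (hI : (Matrix.of fun i j => (multiBinom (m.degree (g j)) (I i) : F)).det ≠ 0) :
    (Matrix.of fun i j => hasseDeriv (I i) (g j)).det ≠ 0 := by
  let M : Matrix ι ι (MvPolynomial σ F) :=
    Matrix.of fun i j => monomial (I i) 1 * hasseDeriv (I i) (g j)
  have hcoeffM (i j : ι) (b : σ →₀ ℕ) :
      coeff b (M i j) = multiBinom b (I i) * coeff b (g j) := coeff_monomial_mul_hasseDeriv _ _ _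
  have hdegree (i j : ι) : m.degree (M i j) ≼[m] m.degree (g j) := m.degree_le_iff.2 fun b hb => by
    rw [mem_support_iff, hcoeffM] at hb
    exact m.le_degree (mem_support_iff.2 (right_ne_zero_of_mul hb))
  have hcoeff : coeff (∑ j, m.degree (g j)) M.det =
      (∏ j, m.leadingCoeff (g j)) *
        (Matrix.of fun i j => (multiBinom (m.degree (g j)) (I i) : F)).det := by
    rw [← Matrix.det_mul_row, Matrix.det_apply, Matrix.det_apply, coeff_sum]
    refine Finset.sum_congr rfl fun π _ => ?_
    rw [Units.smul_def, Units.smul_def, coeff_smul,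
      coeff_prod_of_degree_le m fun j _ => hdegree _ j]
    exact congrArg _ (Finset.prod_congr rfl fun j _ => (hcoeffM _ _ _).trans (mul_comm _ _))
  have hM : M.det = (∏ i, monomial (I i) 1) * (Matrix.of fun i j => hasseDeriv (I i) (g j)).det :=
    Matrix.det_mul_column _ _
  intro h0
  rw [hM, h0, mul_zero, coeff_zero] at hcoeff
  exact mul_ne_zero (Finset.prod_ne_zero_iff.2 fun j _ => m.leadingCoeff_ne_zero_iff.2 (hg j)) hI
    hcoeff.symm

theorem exists_det_hasseDeriv_ne_zero [CharZero F] {f : ι → MvPolynomial σ F}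
    (hf : LinearIndependent F f) :
    ∃ I : ι → σ →₀ ℕ, (∀ i, ∑ x, I i x ≤ Fintype.card ι - 1) ∧
      (Matrix.of fun i j => hasseDeriv (I i) (f j)).det ≠ 0 := by
  let : LinearOrder σ := LinearOrder.lift' (Fintype.equivFin σ) (Fintype.equivFin σ).injective
  obtain ⟨g, hgf, hg0, hginj⟩ := exists_injective_degree (MonomialOrder.lex (σ := σ)) hf
  obtain ⟨I, hI, hdet⟩ := exists_det_multiBinom_ne_zero (F := F) hginj
  refine ⟨I, hI, fun h0 => det_hasseDeriv_ne_zero _ hg0 hdet ?_⟩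
  choose a ha using fun j => (Submodule.mem_span_range_iff_exists_fun F).1 (hgf j)
  have hmul : (Matrix.of fun i j => hasseDeriv (I i) (g j)) =
      (Matrix.of fun i j => hasseDeriv (I i) (f j)) * Matrix.of fun i j => C (a j i) := by
    ext1 i j
    rw [Matrix.mul_apply, Matrix.of_apply, ← ha j, hasseDeriv_sum]
    refine Finset.sum_congr rfl fun l _ => ?_
    rw [smul_eq_C_mul, hasseDeriv_C_mul, Matrix.of_apply, Matrix.of_apply, mul_comm]
  rw [hmul, Matrix.det_mul, h0, zero_mul]

end Wronskian

section RootMultiplicity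

open NumberField Polynomial Height

section Place

variable {K : Type*} [Field K]

theorem finitePlace_intCast_le_one [NumberField K] (v : FinitePlace K) (n : ℤ) : v (n : K) ≤ 1 := by
  rw [← FinitePlace.norm_embedding_eq]
  simpa using FinitePlace.norm_le_one K v.maximalIdeal (n : 𝓞 K)

variable {V : ℤ[X]} {β : K} {s : ℕ} {Q : K[X]}

/- Both local estimates say that a multiplicative size of polynomials, namely the Gauss norm or the
Mahler measure, of `X - β` is at least `max |β| 1`. -/
theorem finitePlace_leadingCoeff_mul_le [NumberField K]
    (hQ : V.map (Int.castRingHom K) = (X - C β) ^ s * Q) (v : FinitePlace K) :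
    v Q.leadingCoeff * max (v β) 1 ^ s ≤ 1 := by
  have hna : IsNonarchimedean v.val := FinitePlace.add_le v
  have hpow (n : ℕ) : gaussNorm v.val 1 ((X - C β) ^ n) = gaussNorm v.val 1 (X - C β) ^ n := by
    induction n with
    | zero => rw [pow_zero, pow_zero, ← C_1, gaussNorm_C, map_one]
    | succ n ih => rw [pow_succ, gaussNorm_mul hna one_pos, ih, pow_succ]
  have hV : gaussNorm v.val 1 (V.map (Int.castRingHom K)) ≤ 1 := by
    obtain ⟨i, hi⟩ := exists_eq_gaussNorm v.val 1 (V.map (Int.castRingHom K))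
    rw [hi, one_pow, mul_one, coeff_map]
    exact finitePlace_intCast_le_one v _
  have hlead : v Q.leadingCoeff ≤ gaussNorm v.val 1 Q := by
    simpa [FinitePlace.coe_apply] using le_gaussNorm v.val Q zero_le_one Q.natDegree
  have hlinear : max (v β) 1 ≤ gaussNorm v.val 1 (X - C β) := by
    have hcoeff := le_gaussNorm v.val (X - C β) zero_le_one
    refine max_le ?_ ?_
    · simpa [FinitePlace.coe_apply] using hcoeff 0
    · simpa [coeff_X, coeff_C] using hcoeff 1
  rw [hQ, gaussNorm_mul hna one_pos, hpow, mul_comm] at hV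
  refine le_trans ?_ hV
  exact mul_le_mul hlead (pow_le_pow_left₀ (by positivity) hlinear _) (by positivity)
    (gaussNorm_nonneg _ _ zero_le_one)

theorem infinitePlace_leadingCoeff_mul_le (hQ : V.map (Int.castRingHom K) = (X - C β) ^ s * Q)
    (v : InfinitePlace K) :
    v Q.leadingCoeff * max (v β) 1 ^ s ≤ V.sum fun _ a => |(a : ℝ)| := by
  have hpow (n : ℕ) : ((X - C (v.embedding β)) ^ n).mahlerMeasure =
      (X - C (v.embedding β)).mahlerMeasure ^ n := by
    induction n with
    | zero => simp
    | succ n ih => rw [pow_succ, mahlerMeasure_mul, ih, pow_succ]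
  have hmap : V.map (Int.castRingHom ℂ) = (X - C (v.embedding β)) ^ s * Q.map v.embedding := by
    have hcomp : Int.castRingHom ℂ = v.embedding.comp (Int.castRingHom K) := RingHom.ext_int _ _
    rw [hcomp, ← Polynomial.map_map, hQ]
    simp
  have hlead : v Q.leadingCoeff ≤ (Q.map v.embedding).mahlerMeasure := by
    simpa [leadingCoeff_map, InfinitePlace.norm_embedding_eq] using
      leadingCoeff_le_mahlerMeasure (Q.map v.embedding)
  have hV : (V.map (Int.castRingHom ℂ)).mahlerMeasure ≤ V.sum fun _ a => |(a : ℝ)| := by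
    refine (mahlerMeasure_le_sum_norm_coeff _).trans_eq ?_
    rw [Polynomial.sum_def, Polynomial.sum_def,
      support_map_of_injective _ (RingHom.injective_int _)]
    exact Finset.sum_congr rfl fun i _ => by simp
  rw [hmap, mahlerMeasure_mul, hpow, mahlerMeasure_X_sub_C, InfinitePlace.norm_embedding_eq,
    max_comm, mul_comm] at hV
  exact (mul_le_mul_of_nonneg_right hlead (by positivity)).trans hV

end Place

variable {K : Type*} [Field K] [NumberField K]

theorem mulHeight₁_pow_le {V : ℤ[X]} {β : K} {s : ℕ} {Q : K[X]}
    (hQ : V.map (Int.castRingHom K) = (X - C β) ^ s * Q) (hQ0 : Q ≠ 0) :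
    mulHeight₁ β ^ s ≤ (V.sum fun _ a => |(a : ℝ)|) ^ Module.finrank ℚ K := by
  have hlead : Q.leadingCoeff ≠ 0 := leadingCoeff_ne_zero.2 hQ0
  have hfinlead := FinitePlace.hasFiniteMulSupport (K := K) hlead
  have hfinβ : (fun v : FinitePlace K => max (v β) 1).HasFiniteMulSupport := by
    rcases eq_or_ne β 0 with rfl | hβ
    · simpa using! Function.hasFiniteMulSupport_one
    · exact (FinitePlace.hasFiniteMulSupport hβ).max Function.hasFiniteMulSupport_fun_one
  have hfinpow : (fun v : FinitePlace K => max (v β) 1 ^ s).HasFiniteMulSupport := hfinβ.pow s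
  have hfinite : ∏ᶠ v : FinitePlace K, v Q.leadingCoeff * max (v β) 1 ^ s ≤ 1 :=
    (finprod_le_finprod (hfinlead.mul hfinpow)
      (fun v => mul_nonneg (apply_nonneg v _) (by positivity))
      Function.hasFiniteMulSupport_fun_one fun v => finitePlace_leadingCoeff_mul_le hQ v).trans_eq
      finprod_one
  calc mulHeight₁ β ^ s
      = ((∏ v : InfinitePlace K, v Q.leadingCoeff ^ v.mult) *
          ∏ᶠ v : FinitePlace K, v Q.leadingCoeff) *
        ((∏ v : InfinitePlace K, max (v β) 1 ^ v.mult) *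
          ∏ᶠ v : FinitePlace K, max (v β) 1) ^ s := by
        rw [prod_abs_eq_one hlead, one_mul, NumberField.mulHeight₁_eq]
    _ = (∏ v : InfinitePlace K, (v Q.leadingCoeff * max (v β) 1 ^ s) ^ v.mult) *
          ∏ᶠ v : FinitePlace K, v Q.leadingCoeff * max (v β) 1 ^ s := by
        rw [finprod_mul_distrib hfinlead hfinpow, mul_pow, finprod_pow hfinβ,
          ← Finset.prod_pow, mul_mul_mul_comm, ← Finset.prod_mul_distrib]
        simp_rw [mul_pow, ← pow_mul, mul_comm s]
    _ ≤ (∏ v : InfinitePlace K, (V.sum fun _ a => |(a : ℝ)|) ^ v.mult) * 1 := by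
        refine mul_le_mul ?_ hfinite (finprod_nonneg fun v => by positivity)
          (Finset.prod_nonneg fun v _ => pow_nonneg (Finset.sum_nonneg fun _ _ => abs_nonneg _) _)
        exact Finset.prod_le_prod (fun v _ => by positivity) fun v _ =>
          pow_le_pow_left₀ (by positivity) (infinitePlace_leadingCoeff_mul_le hQ v) _
    _ = (V.sum fun _ a => |(a : ℝ)|) ^ Module.finrank ℚ K := by
        rw [mul_one, Finset.prod_pow_eq_pow_sum, InfinitePlace.sum_mult_eq]

theorem exists_coeff_polynomial_taylor_ne_zero {V : ℤ[X]} (hV : V ≠ 0) (β : K) :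
    ∃ s : ℕ, (Polynomial.taylor β (V.map (Int.castRingHom K))).coeff s ≠ 0 ∧
      s * logHeight₁ β ≤ Module.finrank ℚ K * Real.log (V.sum fun _ a => |(a : ℝ)|) := by
  have hmap : V.map (Int.castRingHom K) ≠ 0 :=
    (Polynomial.map_ne_zero_iff (RingHom.injective_int _)).2 hV
  obtain ⟨Q, hQ, hdvd⟩ := exists_eq_pow_rootMultiplicity_mul_and_not_dvd _ hmap β
  refine ⟨rootMultiplicity β (V.map (Int.castRingHom K)), ?_, ?_⟩
  · have hX : Polynomial.taylor β (X - C β) = X := by simp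
    generalize rootMultiplicity β (V.map (Int.castRingHom K)) = s at hQ ⊢
    rw [hQ, taylor_mul, taylor_pow, hX, mul_comm, coeff_mul_X_pow', if_pos le_rfl, Nat.sub_self,
      taylor_coeff_zero]
    exact fun h => hdvd (dvd_iff_isRoot.2 h)
  · have hQ0 : Q ≠ 0 := by
      rintro rfl
      exact hdvd (dvd_zero _)
    have hlog := Real.log_le_log (pow_pos (mulHeight₁_pos β) _) (mulHeight₁_pow_le hQ hQ0)
    rwa [Real.log_pow, Real.log_pow] at hlog

variable {σ : Type*} [Unique σ]

theorem l1Norm_eq_sum_uniqueAlgEquiv {R : Type*} [CommSemiring R] (v : AbsoluteValue R ℝ)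
    (P : MvPolynomial σ R) :
    l1Norm v P = (MvPolynomial.uniqueAlgEquiv R σ P).sum fun _ a => v a := by
  have hcoeff (e : σ →₀ ℕ) :
      (MvPolynomial.uniqueAlgEquiv R σ P).coeff (e default) = MvPolynomial.coeff e P := by
    rw [MvPolynomial.coeff_uniqueAlgEquiv, ← Finsupp.unique_single]
  rw [l1Norm, Polynomial.sum_def]
  refine Finset.sum_nbij' (fun e => e default) (fun i => Finsupp.single default i) ?_ ?_ ?_ ?_ ?_
  · exact fun e he =>
      Polynomial.mem_support_iff.2 ((hcoeff e).trans_ne (MvPolynomial.mem_support_iff.1 he))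
  · intro i hi
    rw [Polynomial.mem_support_iff, MvPolynomial.coeff_uniqueAlgEquiv] at hi
    exact MvPolynomial.mem_support_iff.2 hi
  · exact fun e _ => (Finsupp.unique_single e).symm
  · exact fun i _ => Finsupp.single_eq_same
  · exact fun e _ => congrArg v (hcoeff e).symm

theorem uniqueAlgEquiv_taylor {A : Type*} [CommRing A] (β : A) (V : MvPolynomial σ ℤ) :
    MvPolynomial.uniqueAlgEquiv A σ (taylor (fun _ => β) V) =
      Polynomial.taylor β ((MvPolynomial.uniqueAlgEquiv ℤ σ V).map (Int.castRingHom A)) := by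
  induction V using MvPolynomial.induction_on with
  | C r =>
    rw [Roth.taylor_C]
    simp only [MvPolynomial.uniqueAlgEquiv_apply, MvPolynomial.eval₂_C, map_C, Polynomial.taylor_C]
    rfl
  | add p q hp hq => simp only [map_add, hp, hq, Polynomial.map_add]
  | mul_X p j hp =>
    simp only [map_mul, hp, Polynomial.map_mul, taylor_mul]
    simp

theorem exists_coeff_taylor_ne_zero {V : MvPolynomial σ ℤ} (hV : V ≠ 0) (β : K) :
    ∃ s : ℕ, MvPolynomial.coeff (Finsupp.single default s) (taylor (fun _ => β) V) ≠ 0 ∧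
      s * logHeight₁ β ≤ Module.finrank ℚ K * Real.log (l1Norm intAbv V) := by
  obtain ⟨s, hs, hle⟩ := exists_coeff_polynomial_taylor_ne_zero
    ((MvPolynomial.uniqueAlgEquiv ℤ σ).map_ne_zero_iff.2 hV) β
  refine ⟨s, ?_, ?_⟩
  · rwa [← MvPolynomial.coeff_uniqueAlgEquiv, uniqueAlgEquiv_taylor]
  · rw [l1Norm_eq_sum_uniqueAlgEquiv]
    exact hle

end RootMultiplicity

section SplitVariable

open MvPolynomial

variable {n : ℕ} {σ τ R A : Type*}

section CommSemiring

variable [CommSemiring R] [CommSemiring A] [Algebra R A]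

/-- The polynomial whose coefficients are those of `W` at the exponents in the image of `φ`. For an
embedding `φ` that fixes some coordinates of the exponent this is a partial coefficient of `W`. -/
noncomputable def slice (φ : (τ →₀ ℕ) ↪ (σ →₀ ℕ)) (W : MvPolynomial σ R) : MvPolynomial τ R :=
  ∑ a ∈ W.support.preimage φ φ.injective.injOn, monomial a (coeff (φ a) W)

theorem coeff_slice (φ : (τ →₀ ℕ) ↪ (σ →₀ ℕ)) (W : MvPolynomial σ R) (a : τ →₀ ℕ) :
    coeff a (slice φ W) = coeff (φ a) W := by
  classical
  rw [slice, coeff_sum]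
  simp only [coeff_monomial, Finset.sum_ite_eq', Finset.mem_preimage]
  exact ite_eq_left_iff.2 fun h => (notMem_support_iff.1 h).symm

theorem l1Norm_slice_le (v : AbsoluteValue R ℝ) (φ : (τ →₀ ℕ) ↪ (σ →₀ ℕ))
    (W : MvPolynomial σ R) : l1Norm v (slice φ W) ≤ l1Norm v W := by
  have hsupp : (slice φ W).support.map φ ⊆ W.support := by
    intro e he
    obtain ⟨a, ha, rfl⟩ := Finset.mem_map.1 he
    rwa [mem_support_iff, coeff_slice, ← mem_support_iff] at ha
  calc l1Norm v (slice φ W) = ∑ e ∈ (slice φ W).support.map φ, v (coeff e W) := by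
        rw [Finset.sum_map]
        exact Finset.sum_congr rfl fun a _ => by rw [coeff_slice]
    _ ≤ l1Norm v W := Finset.sum_le_sum_of_subset_of_nonneg hsupp fun _ _ _ => v.nonneg _

/-- The partial coefficient of `x₀ ^ i` in a polynomial in `x₀, …, xₙ`. -/
noncomputable def tailSlice (i : ℕ) (W : MvPolynomial (Fin (n + 1)) R) : MvPolynomial (Fin n) R :=
  slice ⟨_, Finsupp.cons_right_injective i⟩ W

theorem coeff_tailSlice (i : ℕ) (W : MvPolynomial (Fin (n + 1)) R) (a : Fin n →₀ ℕ) :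
    coeff a (tailSlice i W) = coeff (Finsupp.cons i a) W :=
  coeff_slice _ _ _

theorem degreeOf_tailSlice_le (i : ℕ) (W : MvPolynomial (Fin (n + 1)) R) (j : Fin n) :
    degreeOf j (tailSlice i W) ≤ degreeOf j.succ W := by
  refine degreeOf_le_iff.2 fun a ha => ?_
  rw [mem_support_iff, coeff_tailSlice] at ha
  simpa using degreeOf_le_iff.1 (le_refl (degreeOf j.succ W)) _ (mem_support_iff.2 ha)

/-- The partial coefficient of `x₁ ^ a₁ ⋯ xₙ ^ aₙ` in a polynomial in `x₀, …, xₙ`. -/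
noncomputable def headSlice (a : Fin n →₀ ℕ) (W : MvPolynomial (Fin (n + 1)) R) :
    MvPolynomial (Fin 1) R :=
  slice ⟨fun b => Finsupp.cons (b 0) a, fun _ _ h =>
    Finsupp.ext fun j => Subsingleton.elim 0 j ▸ (Finsupp.cons_injective2 h).1⟩ W

theorem coeff_headSlice (a : Fin n →₀ ℕ) (W : MvPolynomial (Fin (n + 1)) R) (b : Fin 1 →₀ ℕ) :
    coeff b (headSlice a W) = coeff (Finsupp.cons (b 0) a) W :=
  coeff_slice _ _ _

/-- The product `f(x₁, …, xₙ) g(x₀)`. -/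
noncomputable def splitMul (f : MvPolynomial (Fin n) R) (g : MvPolynomial (Fin 1) R) :
    MvPolynomial (Fin (n + 1)) R :=
  rename Fin.succ f * rename (fun _ => 0) g

theorem mapDomain_succ_add_mapDomain_zero (a : Fin n →₀ ℕ) (b : Fin 1 →₀ ℕ) :
    a.mapDomain Fin.succ + b.mapDomain (fun _ => 0) = Finsupp.cons (b 0) a := by
  obtain ⟨i, rfl⟩ : ∃ i, b = Finsupp.single 0 i := ⟨_, Finsupp.unique_single b⟩
  ext j
  refine Fin.cases ?_ (fun j => ?_) j
  · have h0 : a.mapDomain Fin.succ (0 : Fin (n + 1)) = 0 :=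
      Finsupp.mapDomain_of_notMem_range _ _ (by simp)
    simp [h0]
  · simp [Finsupp.mapDomain_apply (Fin.succ_injective n)]

theorem cons_eq_iff {a : Fin n →₀ ℕ} {b : Fin 1 →₀ ℕ} {e : Fin (n + 1) →₀ ℕ} :
    Finsupp.cons (b 0) a = e ↔ a = e.tail ∧ b = Finsupp.single 0 (e 0) := by
  constructor
  · rintro rfl
    exact ⟨(Finsupp.tail_cons _ _).symm, by rw [Finsupp.cons_zero]; exact Finsupp.unique_single b⟩
  · rintro ⟨rfl, rfl⟩
    rw [Finsupp.single_eq_same, Finsupp.cons_tail]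

theorem coeff_splitMul (f : MvPolynomial (Fin n) R) (g : MvPolynomial (Fin 1) R)
    (e : Fin (n + 1) →₀ ℕ) :
    coeff e (splitMul f g) = coeff e.tail f * coeff (Finsupp.single 0 (e 0)) g := by
  classical
  induction f using MvPolynomial.induction_on' with
  | add p q hp hq =>
    simp only [splitMul, map_add, add_mul, coeff_add] at hp hq ⊢
    rw [hp, hq]
  | monomial a r =>
    induction g using MvPolynomial.induction_on' with
    | add p q hp hq =>
      simp only [splitMul, map_add, mul_add, coeff_add] at hp hq ⊢
      rw [hp, hq]
    | monomial b t =>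
      rw [splitMul, rename_monomial, rename_monomial, monomial_mul,
        mapDomain_succ_add_mapDomain_zero, coeff_monomial, coeff_monomial, coeff_monomial,
        ite_zero_mul_ite_zero]
      simp only [cons_eq_iff]

theorem taylor_rename (u : σ → τ) (b : τ → A) (p : MvPolynomial σ R) :
    taylor b (rename u p) = rename u (taylor (fun j => b (u j)) p) := by
  induction p using MvPolynomial.induction_on with
  | C r => simp
  | add p q hp hq => simp [hp, hq]
  | mul_X p j hp => simp [hp]

theorem taylor_splitMul (a : Fin (n + 1) → A) (f : MvPolynomial (Fin n) R)
    (g : MvPolynomial (Fin 1) R) :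
    taylor a (splitMul f g) =
      splitMul (taylor (fun j => a j.succ) f) (taylor (fun _ => a 0) g) := by
  rw [splitMul, map_mul, taylor_rename, taylor_rename, splitMul]

theorem hasseDeriv_splitMul (J : Fin (n + 1) →₀ ℕ) (f : MvPolynomial (Fin n) R)
    (g : MvPolynomial (Fin 1) R) :
    hasseDeriv J (splitMul f g) =
      splitMul (hasseDeriv J.tail f) (hasseDeriv (Finsupp.single 0 (J 0)) g) := by
  have hf := map_taylor (R := R) (X : Fin n → MvPolynomial (Fin n) R) (rename Fin.succ) f
  have hg := map_taylor (R := R) (X : Fin 1 → MvPolynomial (Fin 1) R)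
    (rename fun _ => (0 : Fin (n + 1))) g
  simp only [rename_X] at hf hg
  rw [hasseDeriv, taylor_splitMul, coeff_splitMul, ← hf, ← hg, coeff_map, coeff_map]
  rfl

end CommSemiring

theorem C_mul_eq_splitMul_slice [CommRing R] {F : Type*} [CommRing F] {φ : R →+* F}
    (hφ : Function.Injective φ) {W : MvPolynomial (Fin (n + 1)) R} {f : MvPolynomial (Fin n) F}
    {g : MvPolynomial (Fin 1) F} (h : map φ W = splitMul f g) (e : Fin (n + 1) →₀ ℕ) :
    C (coeff e W) * W = splitMul (tailSlice (e 0) W) (headSlice e.tail W) := by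
  have hcoeff (b : Fin (n + 1) →₀ ℕ) :
      φ (coeff b W) = coeff b.tail f * coeff (Finsupp.single 0 (b 0)) g := by
    rw [← coeff_splitMul, ← h, coeff_map]
  ext b
  rw [coeff_C_mul, coeff_splitMul, coeff_tailSlice, coeff_headSlice]
  apply hφ
  simp only [map_mul, hcoeff, Finsupp.tail_cons, Finsupp.cons_zero, Finsupp.single_eq_same]
  ring

end SplitVariable

section SplitWronskian

open MvPolynomial

variable {n k : ℕ} {R F : Type*} [Field F]

theorem exists_linearIndependent_decomposition {ι V : Type*} [Fintype ι] [AddCommGroup V]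
    [Module F V] (p : ι → V) :
    ∃ (k : ℕ) (f : Fin k → V) (c : Fin k → ι → F), k ≤ Fintype.card ι ∧
      LinearIndependent F f ∧ LinearIndependent F c ∧ ∀ i, p i = ∑ j, c j i • f j := by
  let M := Submodule.span F (Set.range p)
  have : FiniteDimensional F M := FiniteDimensional.span_of_finite F (Set.finite_range p)
  let b := Module.finBasis F M
  let q (i : ι) : M := ⟨p i, Submodule.subset_span ⟨i, rfl⟩⟩
  have hq : Submodule.span F (Set.range q) = ⊤ := by
    have hpq : p = M.subtype ∘ q := rfl
    apply Submodule.map_injective_of_injective M.subtype_injective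
    rw [Submodule.map_span, ← Set.range_comp, ← hpq, Submodule.map_subtype_top]
  refine ⟨_, fun j => b j, fun j i => b.repr (q i) j, finrank_range_le_card p,
    b.linearIndependent.map' M.subtype M.ker_subtype, ?_, fun i => ?_⟩
  · refine Fintype.linearIndependent_iff.2 fun c hc j => ?_
    have hzero : b.constr F c = 0 := LinearMap.ext_on_range hq fun i => by
      have hi := congrFun hc i
      simp only [Finset.sum_apply, Pi.smul_apply, smul_eq_mul, Pi.zero_apply] at hi
      simpa [Module.Basis.constr_apply_fintype, mul_comm] using hi
    simpa using DFunLike.congr_fun hzero (b j)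
  · have hi := congrArg M.subtype (b.sum_repr (q i))
    rw [map_sum] at hi
    exact hi.symm

theorem exists_sum_splitMul {P : MvPolynomial (Fin (n + 1)) F} {D : ℕ} (hD : degreeOf 0 P ≤ D) :
    ∃ (k : ℕ) (f : Fin k → MvPolynomial (Fin n) F) (g : Fin k → MvPolynomial (Fin 1) F),
      k ≤ D + 1 ∧ LinearIndependent F f ∧ LinearIndependent F g ∧
      P = ∑ j, splitMul (f j) (g j) := by
  classical
  obtain ⟨k, f, c, hk, hf, hc, hdec⟩ :=
    exists_linearIndependent_decomposition (F := F) fun i : Fin (D + 1) => tailSlice (i : ℕ) P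
  let g (j : Fin k) : MvPolynomial (Fin 1) F :=
    ∑ i : Fin (D + 1), monomial (Finsupp.single 0 (i : ℕ)) (c j i)
  have hg (j : Fin k) (i : Fin (D + 1)) : coeff (Finsupp.single 0 (i : ℕ)) (g j) = c j i := by
    simp [g, coeff_sum, coeff_monomial, (Finsupp.single_injective (0 : Fin 1)).eq_iff, Fin.val_inj]
  have hg_eq_zero (j : Fin k) {l : ℕ} (hl : D < l) : coeff (Finsupp.single 0 l) (g j) = 0 := by
    rw [coeff_sum]
    refine Finset.sum_eq_zero fun i _ => ?_
    rw [coeff_monomial, if_neg]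
    exact fun h => (Nat.lt_succ_iff.1 i.2).not_gt (Finsupp.single_injective _ h ▸ hl)
  refine ⟨k, f, g, hk.trans_eq (Fintype.card_fin _), hf, ?_, ?_⟩
  · refine Fintype.linearIndependent_iff.2 fun a ha =>
      Fintype.linearIndependent_iff.1 hc a (funext fun i => ?_)
    simpa [coeff_sum, coeff_smul, hg] using congrArg (coeff (Finsupp.single 0 (i : ℕ))) ha
  · ext e
    simp only [coeff_sum, coeff_splitMul]
    rcases lt_or_ge D (e 0) with he | he
    · simp only [hg_eq_zero _ he, mul_zero, Finset.sum_const_zero]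
      by_contra hne
      exact he.not_ge ((degreeOf_le_iff.1 hD) e (mem_support_iff.2 hne))
    · have htail := congrArg (coeff e.tail) (hdec ⟨e 0, Nat.lt_succ_iff.2 he⟩)
      rw [coeff_tailSlice, Finsupp.cons_tail, coeff_sum] at htail
      rw [htail]
      exact Finset.sum_congr rfl fun j _ => by
        rw [coeff_smul, smul_eq_mul, mul_comm, ← hg]

theorem det_hasseDeriv_single_ne_zero [CharZero F] {g : Fin k → MvPolynomial (Fin 1) F}
    (hg : LinearIndependent F g) :
    (Matrix.of fun i j : Fin k => hasseDeriv (Finsupp.single 0 (i : ℕ)) (g j)).det ≠ 0 := by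
  obtain ⟨N, hN, hdet⟩ := exists_det_hasseDeriv_ne_zero hg
  have hsingle (i : Fin k) : N i = Finsupp.single 0 (N i 0) := Finsupp.unique_single _
  have hlt (i : Fin k) : N i 0 < k := by
    have hi := hN i
    rw [Fin.sum_univ_one, Fintype.card_fin] at hi
    have := i.pos
    omega
  have hinj : Function.Injective fun i => (⟨N i 0, hlt i⟩ : Fin k) := by
    intro i i' h
    by_contra hne
    refine hdet (Matrix.det_zero_of_row_eq hne ?_)
    have hii' : N i = N i' := by rw [hsingle i, hsingle i', Fin.mk.inj h]
    ext1 j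
    rw [Matrix.of_apply, Matrix.of_apply, hii']
  let π : Equiv.Perm (Fin k) := Equiv.ofBijective _ (Finite.injective_iff_bijective.1 hinj)
  intro h0
  have hperm := Matrix.det_permute π
    (Matrix.of fun i j : Fin k => hasseDeriv (Finsupp.single 0 (i : ℕ)) (g j))
  rw [h0, mul_zero] at hperm
  refine hdet (Eq.trans (congrArg _ ?_) hperm)
  ext1 i j
  simp only [Matrix.of_apply, Matrix.submatrix_apply, id_eq]
  rw [hsingle i]
  rfl

/-- The generalized Wronskian of `P` formed with the derivatives of orders `0, …, k - 1` in the
variable `x₀` and of orders `I i` in the other variables. -/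
noncomputable def splitWronskian [CommRing R] (I : Fin k → Fin n →₀ ℕ)
    (P : MvPolynomial (Fin (n + 1)) R) : MvPolynomial (Fin (n + 1)) R :=
  (Matrix.of fun i l : Fin k => hasseDeriv (Finsupp.cons (l : ℕ) (I i)) P).det

theorem map_splitWronskian {S : Type*} [CommRing R] [CommRing S] (φ : R →+* S)
    (I : Fin k → Fin n →₀ ℕ) (P : MvPolynomial (Fin (n + 1)) R) :
    map φ (splitWronskian I P) = splitWronskian I (map φ P) := by
  rw [splitWronskian, RingHom.map_det]
  exact congrArg _ (Matrix.ext fun i l => (hasseDeriv_map _ _ _).symm)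

theorem taylor_splitWronskian {A : Type*} [CommRing R] [CommRing A] [Algebra R A]
    (β : Fin (n + 1) → A) (I : Fin k → Fin n →₀ ℕ) (P : MvPolynomial (Fin (n + 1)) R) :
    taylor β (splitWronskian I P) = splitWronskian I (taylor β P) := by
  rw [splitWronskian, AlgHom.map_det]
  exact congrArg _ (Matrix.ext fun i l => (hasseDeriv_taylor _ _ _).symm)

theorem splitWronskian_sum_splitMul [CommRing R] (I : Fin k → Fin n →₀ ℕ)
    (f : Fin k → MvPolynomial (Fin n) R) (g : Fin k → MvPolynomial (Fin 1) R) :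
    splitWronskian I (∑ j, splitMul (f j) (g j)) =
      splitMul (Matrix.of fun i j => hasseDeriv (I i) (f j)).det
        (Matrix.of fun l j : Fin k => hasseDeriv (Finsupp.single 0 (l : ℕ)) (g j)).det := by
  have hmul : (Matrix.of fun i l : Fin k =>
        hasseDeriv (Finsupp.cons (l : ℕ) (I i)) (∑ j, splitMul (f j) (g j))) =
      (rename Fin.succ).mapMatrix (Matrix.of fun i j => hasseDeriv (I i) (f j)) *
        ((rename fun _ : Fin 1 => (0 : Fin (n + 1))).mapMatrix (Matrix.of fun l j : Fin k =>
          hasseDeriv (Finsupp.single 0 (l : ℕ)) (g j))).transpose := by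
    ext1 i l
    rw [Matrix.mul_apply, Matrix.of_apply, hasseDeriv_sum]
    refine Finset.sum_congr rfl fun j _ => ?_
    rw [hasseDeriv_splitMul, Finsupp.tail_cons, Finsupp.cons_zero]
    rfl
  rw [splitWronskian, hmul, Matrix.det_mul, Matrix.det_transpose, ← AlgHom.map_det,
    ← AlgHom.map_det, splitMul]

theorem exists_splitWronskian_eq_splitMul [CharZero F] {P : MvPolynomial (Fin (n + 1)) F}
    (hP : P ≠ 0) {D : ℕ} (hD : degreeOf 0 P ≤ D) :
    ∃ (k : ℕ) (I : Fin k → Fin n →₀ ℕ), 0 < k ∧ k ≤ D + 1 ∧ (∀ i, ∑ x, I i x ≤ k - 1) ∧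
      ∃ (f : MvPolynomial (Fin n) F) (g : MvPolynomial (Fin 1) F),
        f ≠ 0 ∧ g ≠ 0 ∧ splitWronskian I P = splitMul f g := by
  obtain ⟨k, f, g, hkD, hf, hg, hdec⟩ := exists_sum_splitMul hD
  obtain ⟨I, hI, hdet⟩ := exists_det_hasseDeriv_ne_zero hf
  rw [Fintype.card_fin] at hI
  refine ⟨k, I, ?_, hkD, hI, _, _, hdet, det_hasseDeriv_single_ne_zero hg, ?_⟩
  · refine Nat.pos_of_ne_zero ?_
    rintro rfl
    exact hP (hdec.trans (Fin.sum_univ_zero _))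
  · rw [hdec, splitWronskian_sum_splitMul]

theorem splitMul_ne_zero {f : MvPolynomial (Fin n) F} {g : MvPolynomial (Fin 1) F} (hf : f ≠ 0)
    (hg : g ≠ 0) : splitMul f g ≠ 0 :=
  mul_ne_zero ((map_ne_zero_iff _ (rename_injective _ (Fin.succ_injective n))).2 hf)
    ((map_ne_zero_iff _ (rename_injective _ (Function.injective_of_subsingleton _))).2 hg)

end SplitWronskian

section RothLemma

open MvPolynomial Height

variable {n k : ℕ}

theorem degreeOf_det_le {σ R ι : Type*} [CommRing R] [Fintype ι] [DecidableEq ι]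
    (M : Matrix ι ι (MvPolynomial σ R)) (x : σ) {D : ℕ} (hD : ∀ i j, degreeOf x (M i j) ≤ D) :
    degreeOf x M.det ≤ Fintype.card ι * D := by
  let ω : (σ →₀ ℕ) →+ ℝ := -(Nat.castAddMonoidHom ℝ).comp (Finsupp.applyAddHom x)
  have hdet : OrderGE ω (∑ _j : ι, -(D : ℝ)) M.det := by
    refine OrderGE.det fun i j e he => neg_le_neg ?_
    exact Nat.cast_le.2 (degreeOf_le_iff.1 (hD i j) e (mem_support_iff.2 he))
  refine degreeOf_le_iff.2 fun e he => ?_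
  have hle : (∑ _j : ι, -(D : ℝ)) ≤ -(e x : ℝ) := hdet e (mem_support_iff.1 he)
  rw [Finset.sum_const, Finset.card_univ, nsmul_eq_mul, mul_neg, neg_le_neg_iff] at hle
  exact_mod_cast hle

theorem degreeOf_splitWronskian_le {R : Type*} [CommRing R] (I : Fin k → Fin n →₀ ℕ)
    (P : MvPolynomial (Fin (n + 1)) R) (j : Fin (n + 1)) :
    degreeOf j (splitWronskian I P) ≤ k * degreeOf j P :=
  (degreeOf_det_le _ j fun _ _ => degreeOf_hasseDeriv_le _ _ _).trans_eq
    (by rw [Fintype.card_fin])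

theorem log_l1Norm_splitWronskian_le {I : Fin k → Fin n →₀ ℕ} {P : MvPolynomial (Fin (n + 1)) ℤ}
    (hP : P ≠ 0) (hW : splitWronskian I P ≠ 0) {d : Fin (n + 1) → ℕ}
    (hdeg : ∀ j, degreeOf j P ≤ d j) (hk : k ≤ d 0 + 1) :
    Real.log (l1Norm intAbv (splitWronskian I P)) ≤
      k * (Real.log (l1Norm intAbv P) + 2 * ∑ j, (d j : ℝ)) := by
  have hP0 : 0 < l1Norm intAbv P := one_pos.trans_le (one_le_l1Norm_intAbv hP)
  have hfactorial : (k.factorial : ℝ) ≤ (2 ^ ∑ j, d j) ^ k := by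
    have hd0 : d 0 ≤ ∑ j, d j := Finset.single_le_sum (fun _ _ => Nat.zero_le _) (Finset.mem_univ 0)
    have hk2 : k ≤ 2 ^ ∑ j, d j := hk.trans
      (Nat.lt_two_pow_self.trans_le (Nat.pow_le_pow_right two_pos hd0))
    exact_mod_cast (Nat.factorial_le_pow k).trans (Nat.pow_le_pow_left hk2 k)
  have hnorm : l1Norm intAbv (splitWronskian I P) ≤ (4 ^ (∑ j, d j) * l1Norm intAbv P) ^ k := by
    calc l1Norm intAbv (splitWronskian I P)
        ≤ k.factorial * (2 ^ (∑ j, d j) * l1Norm intAbv P) ^ k := by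
          refine (l1Norm_det_le intAbv _ fun i l => l1Norm_hasseDeriv_le intAbv hdeg _).trans_eq ?_
          rw [Fintype.card_fin]
      _ ≤ (2 ^ (∑ j, d j)) ^ k * (2 ^ (∑ j, d j) * l1Norm intAbv P) ^ k := by gcongr
      _ = (4 ^ (∑ j, d j) * l1Norm intAbv P) ^ k := by
          rw [← mul_pow, ← mul_assoc, ← mul_pow]
          norm_num
  have hlog4 : Real.log 4 ≤ 2 := by
    rw [show (4 : ℝ) = 2 ^ 2 by norm_num, Real.log_pow]
    have := Real.log_two_lt_d9
    norm_num
    linarith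
  calc Real.log (l1Norm intAbv (splitWronskian I P))
      ≤ Real.log ((4 ^ (∑ j, d j) * l1Norm intAbv P) ^ k) :=
        Real.log_le_log (one_pos.trans_le (one_le_l1Norm_intAbv hW)) hnorm
    _ = k * (Real.log (l1Norm intAbv P) + Real.log 4 * ∑ j, (d j : ℝ)) := by
        rw [Real.log_pow, Real.log_mul (by positivity) hP0.ne', Real.log_pow]
        push_cast
        ring
    _ ≤ k * (Real.log (l1Norm intAbv P) + 2 * ∑ j, (d j : ℝ)) := by gcongr

theorem exists_C_mul_splitWronskian_eq {R : Type*} [CommRing R] [IsDomain R] [CharZero R]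
    {P : MvPolynomial (Fin (n + 1)) R} (hP : P ≠ 0) {D : ℕ} (hD : degreeOf 0 P ≤ D) :
    ∃ (k : ℕ) (I : Fin k → Fin n →₀ ℕ), 0 < k ∧ k ≤ D + 1 ∧ (∀ i, ∑ x, I i x ≤ k - 1) ∧
      ∃ e, coeff e (splitWronskian I P) ≠ 0 ∧
        C (coeff e (splitWronskian I P)) * splitWronskian I P =
          splitMul (tailSlice (e 0) (splitWronskian I P))
            (headSlice e.tail (splitWronskian I P)) := by
  let F := FractionRing R
  have hinj : Function.Injective (algebraMap R F) := IsFractionRing.injective R F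
  have : CharZero F := charZero_of_injective_algebraMap hinj
  have hPF : map (algebraMap R F) P ≠ 0 := (map_ne_zero_iff _ (map_injective _ hinj)).2 hP
  have hDF : degreeOf 0 (map (algebraMap R F) P) ≤ D := by
    rw [degreeOf_le_iff] at hD ⊢
    exact fun e he => hD e (support_map_subset _ _ he)
  obtain ⟨k, I, hk, hkD, hI, f, g, hf, hg, hsplit⟩ := exists_splitWronskian_eq_splitMul hPF hDF
  rw [← map_splitWronskian] at hsplit
  have hW : splitWronskian I P ≠ 0 := fun h =>
    splitMul_ne_zero hf hg (by rw [← hsplit, h, map_zero])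
  obtain ⟨e, he⟩ := ne_zero_iff.1 hW
  exact ⟨k, I, hk, hkD, hI, e, he, C_mul_eq_splitMul_slice hinj hsplit e⟩

theorem coeff_cons_taylor_ne_zero {R A : Type*} [CommSemiring R] [CommSemiring A] [Algebra R A]
    [NoZeroDivisors A] {W : MvPolynomial (Fin (n + 1)) R} {r : R} {f : MvPolynomial (Fin n) R}
    {g : MvPolynomial (Fin 1) R} (h : C r * W = splitMul f g) {β : Fin (n + 1) → A}
    {a : Fin n →₀ ℕ} {s : ℕ} (ha : coeff a (taylor (fun j => β j.succ) f) ≠ 0)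
    (hs : coeff (Finsupp.single 0 s) (taylor (fun _ => β 0) g) ≠ 0) :
    coeff (Finsupp.cons s a) (taylor β W) ≠ 0 := by
  intro h0
  have hcoeff := congrArg (fun Q => coeff (Finsupp.cons s a) (taylor β Q)) h
  simp only [map_mul, taylor_C, coeff_C_mul, h0, mul_zero, taylor_splitMul, coeff_splitMul,
    Finsupp.tail_cons, Finsupp.cons_zero] at hcoeff
  exact mul_ne_zero ha hs hcoeff.symm

theorem indexWeight_cons (d : Fin (n + 1) → ℕ) (s : ℕ) (a : Fin n →₀ ℕ) :
    indexWeight d (Finsupp.cons s a) = s / d 0 + indexWeight (fun j => d j.succ) a := by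
  simp only [indexWeight_apply, Fin.sum_univ_succ, Finsupp.cons_zero, Finsupp.cons_succ]

theorem indexWeight_mul {σ : Type*} [Fintype σ] (k : ℕ) (d : σ → ℕ) (a : σ →₀ ℕ) :
    indexWeight (fun j => k * d j) a = indexWeight d a / k := by
  simp only [indexWeight_apply, Finset.sum_div]
  exact Finset.sum_congr rfl fun j _ => by rw [Nat.cast_mul, div_div, mul_comm]

theorem le_sum_max_sub_div {k D : ℕ} (hD : 0 < D) (hk : k ≤ D + 1) {θ : ℝ} (hθ : 0 < θ)
    (hθ1 : θ ≤ 1) : k * (θ ^ 2 / 8) ≤ ∑ ν : Fin k, max 0 (θ - ν / D) := by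
  have hD' : (0 : ℝ) < D := Nat.cast_pos.2 hD
  set m := ⌊θ * D / 2⌋₊ + 1 with hm
  have hterm (ν : ℕ) (hν : ν < m) : θ / 2 ≤ max 0 (θ - ν / D) := by
    refine le_max_of_le_right ?_
    have hle : (ν : ℝ) ≤ θ * D / 2 :=
      (Nat.le_floor_iff (by positivity)).1 (Nat.lt_succ_iff.1 hν)
    have hdiv : (ν : ℝ) / D ≤ θ / 2 := (div_le_iff₀ hD').2 (by linarith)
    linarith
  have hcard : (k : ℝ) * (θ / 4) ≤ (min k m : ℕ) := by
    rw [Nat.cast_min, le_min_iff]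
    have hfloor : θ * D / 2 < m := by
      rw [hm, Nat.cast_add, Nat.cast_one]
      exact Nat.lt_floor_add_one _
    have hone : (1 : ℝ) ≤ m := by exact_mod_cast Nat.succ_pos _
    have hkD : (k : ℝ) ≤ D + 1 := by exact_mod_cast hk
    constructor <;> nlinarith [Nat.cast_nonneg (α := ℝ) k]
  calc k * (θ ^ 2 / 8) = k * (θ / 4) * (θ / 2) := by ring
    _ ≤ (min k m : ℕ) * (θ / 2) := by gcongr
    _ = ∑ _ν ∈ Finset.range (min k m), θ / 2 := by
        rw [Finset.sum_const, Finset.card_range, nsmul_eq_mul]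
    _ ≤ ∑ ν ∈ Finset.range (min k m), max 0 (θ - ν / D) := Finset.sum_le_sum fun ν hν =>
        hterm ν ((Finset.mem_range.1 hν).trans_le (min_le_right _ _))
    _ ≤ ∑ ν ∈ Finset.range k, max 0 (θ - ν / D) :=
        Finset.sum_le_sum_of_subset_of_nonneg (Finset.range_subset_range.2 (min_le_left _ _))
          fun _ _ _ => le_max_left _ _
    _ = ∑ ν : Fin k, max 0 (θ - ν / D) := (Fin.sum_univ_eq_sum_range _ k).symm

theorem indexWeight_tail_le {d : Fin (n + 1) → ℕ} {C : ℝ} (hC : 0 < C) (hd : 0 < d 0)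
    (hgap : ∀ i j, i < j → C * d i ≤ d j) {I : Fin n →₀ ℕ} (hI : ∑ x, I x ≤ d 0) :
    indexWeight (fun j => d j.succ) I ≤ 1 / C := by
  have : (0 : ℝ) < d 0 := Nat.cast_pos.2 hd
  calc indexWeight (fun j => d j.succ) I ≤ ∑ j, (I j : ℝ) * (1 / (C * d 0)) := by
        rw [indexWeight_apply]
        refine Finset.sum_le_sum fun j _ => ?_
        rw [div_eq_mul_one_div]
        gcongr
        exact hgap 0 j.succ (Fin.succ_pos j)
    _ = (∑ j, I j : ℕ) * (1 / (C * d 0)) := by rw [← Finset.sum_mul, Nat.cast_sum]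
    _ ≤ d 0 * (1 / (C * d 0)) := by gcongr
    _ = 1 / C := by field_simp

theorem OrderGE.splitWronskian {R : Type*} [CommRing R] {d : Fin (n + 1) → ℕ} {η δ : ℝ}
    {P : MvPolynomial (Fin (n + 1)) R} (hP : OrderGE (indexWeight d) η P)
    {I : Fin k → Fin n →₀ ℕ} (hI : ∀ i, indexWeight (fun j => d j.succ) (I i) ≤ δ) :
    OrderGE (indexWeight d) (∑ l : Fin k, max 0 (η - δ - l / d 0)) (splitWronskian I P) := by
  refine OrderGE.det fun i l e he => max_le (indexWeight_nonneg d e) ?_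
  refine le_trans ?_ (hP.hasseDeriv _ e he)
  rw [indexWeight_cons]
  linarith [hI i]

/-- The conclusion of Roth's lemma: the constant `C` forces every non-zero integer polynomial in
`n` variables to have index at most `η` at each point of `Kⁿ` whose coordinates have large heights,
when its partial degrees are rapidly increasing. -/
def IndexBound (K : Type*) [Field K] [NumberField K] (n : ℕ) (η C : ℝ) : Prop :=
  ∀ (d : Fin n → ℕ) (β : Fin n → K) (P : MvPolynomial (Fin n) ℤ), (∀ j, 0 < d j) →
    (∀ i j, i < j → C * d i ≤ d j) → P ≠ 0 → (∀ j, degreeOf j P ≤ d j) →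
    (∀ j, C * (Real.log (l1Norm intAbv P) + ∑ i, (d i : ℝ)) ≤ d j * logHeight₁ (β j)) →
    ∃ e, coeff e (taylor β P) ≠ 0 ∧ indexWeight d e ≤ η

variable {K : Type*} [Field K] [NumberField K]

theorem indexBound_zero {η : ℝ} (hη : 0 ≤ η) (C : ℝ) : IndexBound K 0 η C := by
  intro d β P _ _ hP _ _
  obtain ⟨e, he⟩ := ne_zero_iff.1 ((map_ne_zero_iff _ (taylor_injective β)).2 hP)
  exact ⟨e, he, by simpa [indexWeight_apply] using hη⟩

section Split

variable {d : Fin (n + 1) → ℕ} {β : Fin (n + 1) → K} {W : MvPolynomial (Fin (n + 1)) ℤ}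
  {η C C' M : ℝ}

theorem div_le_of_logHeight₁_le {s d : ℕ} {β : K} (hd : 0 < d) (hC : 0 < C) (hM : 0 < M)
    {N : ℝ} (hN : 0 ≤ N) (hs : s * logHeight₁ β ≤ N * M) (hβ : C * M ≤ d * logHeight₁ β) :
    (s : ℝ) / d ≤ N / C := by
  have hd' : (0 : ℝ) < d := Nat.cast_pos.2 hd
  have hpos : 0 < logHeight₁ β := pos_of_mul_pos_right ((mul_pos hC hM).trans_le hβ) hd'.le
  rw [div_le_div_iff₀ hd' hC]
  refine le_of_mul_le_mul_right ?_ hpos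
  calc (s : ℝ) * C * logHeight₁ β = C * (s * logHeight₁ β) := by ring
    _ ≤ C * (N * M) := by gcongr
    _ = N * (C * M) := by ring
    _ ≤ N * (d * logHeight₁ β) := by gcongr
    _ = N * d * logHeight₁ β := by ring

theorem IndexBound.exists_coeff_taylor_ne_zero (h : IndexBound K n η C') (hk : 0 < k)
    (hC' : 0 ≤ C') (hCC' : 3 * C' ≤ C) (hd : ∀ j, 0 < d j)
    (hgap : ∀ i j, i < j → C * d i ≤ d j) (hβ : ∀ j, C * M ≤ d j * logHeight₁ (β j))
    (hM : 0 ≤ M) {U : MvPolynomial (Fin n) ℤ} (hU : U ≠ 0)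
    (hdeg : ∀ j, degreeOf j U ≤ k * d j.succ)
    (hlog : Real.log (l1Norm intAbv U) + k * ∑ j, (d j : ℝ) ≤ k * (3 * M)) :
    ∃ a, coeff a (taylor (fun j => β j.succ) U) ≠ 0 ∧
      indexWeight (fun j => d j.succ) a ≤ k * η := by
  have hk' : (0 : ℝ) < k := Nat.cast_pos.2 hk
  suffices hex : ∃ a, coeff a (taylor (fun j => β j.succ) U) ≠ 0 ∧
      indexWeight (fun j => k * d j.succ) a ≤ η by
    obtain ⟨a, ha, hwt⟩ := hex
    rw [indexWeight_mul, div_le_iff₀' hk'] at hwt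
    exact ⟨a, ha, hwt⟩
  refine h (fun j => k * d j.succ) (fun j => β j.succ) U
    (fun j => Nat.mul_pos hk (hd _)) ?_ hU hdeg ?_
  · intro i j hij
    calc C' * (k * d i.succ : ℕ) = k * (C' * d i.succ) := by push_cast; ring
      _ ≤ k * (C * d i.succ) := by gcongr; linarith
      _ ≤ k * d j.succ := by gcongr; exact hgap _ _ (Fin.succ_lt_succ_iff.2 hij)
      _ = (k * d j.succ : ℕ) := (Nat.cast_mul _ _).symm
  · intro j
    have hsum : ∑ i : Fin n, ((k * d i.succ : ℕ) : ℝ) ≤ k * ∑ j, (d j : ℝ) := by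
      push_cast
      rw [← Finset.mul_sum, Fin.sum_univ_succ]
      gcongr
      exact le_add_of_nonneg_left (Nat.cast_nonneg _)
    calc C' * (Real.log (l1Norm intAbv U) + ∑ i : Fin n, ((k * d i.succ : ℕ) : ℝ))
        ≤ C' * (k * (3 * M)) := by gcongr; linarith
      _ = k * (3 * C' * M) := by ring
      _ ≤ k * (C * M) := by gcongr
      _ ≤ k * (d j.succ * logHeight₁ (β j.succ)) := mul_le_mul_of_nonneg_left (hβ _) hk'.le
      _ = (k * d j.succ : ℕ) * logHeight₁ (β j.succ) := by push_cast; ring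

theorem IndexBound.exists_coeff_taylor_ne_zero_of_split (h : IndexBound K n (η / 2) C')
    (hη : 0 < η) (hk : 0 < k) (hC' : 0 < C') (hCC' : 3 * C' ≤ C)
    (hC : 6 * Module.finrank ℚ K / η ≤ C) (hd : ∀ j, 0 < d j)
    (hgap : ∀ i j, i < j → C * d i ≤ d j) (hM : 0 < M)
    (hβ : ∀ j, C * M ≤ d j * logHeight₁ (β j)) {e : Fin (n + 1) →₀ ℕ} (he : coeff e W ≠ 0)
    (hsplit : MvPolynomial.C (coeff e W) * W = splitMul (tailSlice (e 0) W) (headSlice e.tail W))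
    (hdeg : ∀ j, degreeOf j W ≤ k * d j)
    (hlog : Real.log (l1Norm intAbv W) + k * ∑ j, (d j : ℝ) ≤ k * (3 * M)) :
    ∃ e, coeff e (taylor β W) ≠ 0 ∧ indexWeight d e ≤ k * η := by
  have hU : tailSlice (e 0) W ≠ 0 :=
    ne_zero_iff.2 ⟨e.tail, by rwa [coeff_tailSlice, Finsupp.cons_tail]⟩
  have hV : headSlice e.tail W ≠ 0 := ne_zero_iff.2
    ⟨Finsupp.single 0 (e 0), by rwa [coeff_headSlice, Finsupp.single_eq_same, Finsupp.cons_tail]⟩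
  have hlogU : Real.log (l1Norm intAbv (tailSlice (e 0) W)) ≤ Real.log (l1Norm intAbv W) :=
    Real.log_le_log (one_pos.trans_le (one_le_l1Norm_intAbv hU)) (l1Norm_slice_le _ _ _)
  have hlogV : Real.log (l1Norm intAbv (headSlice e.tail W)) ≤ Real.log (l1Norm intAbv W) :=
    Real.log_le_log (one_pos.trans_le (one_le_l1Norm_intAbv hV)) (l1Norm_slice_le _ _ _)
  obtain ⟨a, ha, hwt⟩ := h.exists_coeff_taylor_ne_zero hk hC'.le hCC' hd hgap hβ hM.le hU
    (fun j => (degreeOf_tailSlice_le _ _ _).trans (hdeg _)) (by linarith)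
  obtain ⟨s, hs, hheight⟩ := Roth.exists_coeff_taylor_ne_zero hV (β 0)
  refine ⟨Finsupp.cons s a, coeff_cons_taylor_ne_zero hsplit ha hs, ?_⟩
  have hsum : 0 ≤ k * ∑ j, (d j : ℝ) := by positivity
  have hs_le : (s : ℝ) / d 0 ≤ Module.finrank ℚ K * (k * 3) / C := by
    refine div_le_of_logHeight₁_le (hd 0) (by linarith) hM (by positivity) (hheight.trans ?_) (hβ 0)
    rw [mul_assoc, mul_assoc]
    gcongr
    linarith
  have hC_le : Module.finrank ℚ K * (k * 3) / C ≤ k * (η / 2) := by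
    rw [div_le_iff₀ hη] at hC
    rw [div_le_iff₀ (by linarith)]
    calc (Module.finrank ℚ K : ℝ) * (k * 3) = k / 2 * (6 * Module.finrank ℚ K) := by ring
      _ ≤ k / 2 * (C * η) := by gcongr
      _ = k * (η / 2) * C := by ring
  rw [indexWeight_cons]
  linarith

end Split

theorem IndexBound.succ {η C C' : ℝ} (h : IndexBound K n (η ^ 2 / 128) C') (hη : 0 < η)
    (hη1 : η ≤ 1) (hC' : 0 < C') (hCC' : 3 * C' ≤ C) (hC2 : 2 / η ≤ C)
    (hC : 384 * Module.finrank ℚ K / η ^ 2 ≤ C) : IndexBound K (n + 1) η C := by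
  intro d β P hd hgap hP hdeg hβ
  by_contra! hcon
  have hord : OrderGE (indexWeight d) η (taylor β P) := fun e he => (hcon e he).le
  obtain ⟨k, I, hk, hkD, hI, e, he, hsplit⟩ := exists_C_mul_splitWronskian_eq hP (hdeg 0)
  have hW : splitWronskian I P ≠ 0 := ne_zero_iff.2 ⟨e, he⟩
  have hL : 0 ≤ Real.log (l1Norm intAbv P) := Real.log_nonneg (one_le_l1Norm_intAbv hP)
  have hD : 0 < ∑ j, (d j : ℝ) :=
    Finset.sum_pos (fun j _ => Nat.cast_pos.2 (hd j)) Finset.univ_nonempty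
  have hlog := log_l1Norm_splitWronskian_le hP hW hdeg hkD
  have hk' : (0 : ℝ) < k := Nat.cast_pos.2 hk
  obtain ⟨b, hb, hupper⟩ := IndexBound.exists_coeff_taylor_ne_zero_of_split (η := η ^ 2 / 64)
    (by rwa [div_div, ← show (128 : ℝ) = 64 * 2 by norm_num]) (by positivity) hk hC' hCC'
    (by rwa [div_div_eq_mul_div, mul_right_comm, ← show (384 : ℝ) = 6 * 64 by norm_num])
    hd hgap (by positivity) hβ he hsplit
    (fun j => (degreeOf_splitWronskian_le I P j).trans (Nat.mul_le_mul_left k (hdeg j)))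
    (by nlinarith)
  have hδ (i : Fin k) : indexWeight (fun j => d j.succ) (I i) ≤ η / 2 := by
    refine (indexWeight_tail_le (by linarith) (hd 0) hgap ((hI i).trans (by omega))).trans ?_
    rw [← one_div_div 2 η]
    exact one_div_le_one_div_of_le (by positivity) hC2
  rw [taylor_splitWronskian] at hb
  have hlower := hord.splitWronskian hδ b hb
  rw [sub_half] at hlower
  have hcount := le_sum_max_sub_div (hd 0) hkD (half_pos hη) (by linarith)
  have hle := le_of_mul_le_mul_left (hcount.trans (hlower.trans hupper)) hk'
  nlinarith [pow_pos hη 2]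

theorem exists_indexBound (n : ℕ) {η : ℝ} (hη : 0 < η) : ∃ C, 1 ≤ C ∧ IndexBound K n η C := by
  induction n generalizing η with
  | zero => exact ⟨1, le_rfl, indexBound_zero hη.le 1⟩
  | succ n ih =>
    set θ := min η 1
    have hθ : 0 < θ := lt_min hη one_pos
    obtain ⟨C', hC'1, hC'⟩ := ih (η := θ ^ 2 / 128) (by positivity)
    have h2 : 0 ≤ 2 / θ := by positivity
    have h384 : 0 ≤ 384 * Module.finrank ℚ K / θ ^ 2 := by positivity
    refine ⟨3 * C' + 2 / θ + 384 * Module.finrank ℚ K / θ ^ 2, by linarith,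
      fun d β P hd hgap hP hdeg hβ => ?_⟩
    obtain ⟨e, he, hle⟩ := hC'.succ hθ (min_le_right _ _) (by linarith) (by linarith) (by linarith)
      (by linarith) d β P hd hgap hP hdeg hβ
    exact ⟨e, he, hle.trans (min_le_left _ _)⟩

end RothLemma

section IntegralPowers

theorem exists_natCast_mul_isIntegral {L : Type*} [CommRing L] {α : L} (hα : IsAlgebraic ℤ α) :
    ∃ c : ℕ, c ≠ 0 ∧ IsIntegral ℤ (c * α) := by
  obtain ⟨y, hy, hint⟩ := hα.exists_integral_multiple
  rw [zsmul_eq_mul] at hint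
  refine ⟨y.natAbs, Int.natAbs_ne_zero.2 hy, ?_⟩
  rcases y.natAbs_eq with h | h
  · rwa [h, Int.cast_natCast] at hint
  · rw [h, Int.cast_neg, Int.cast_natCast, neg_mul] at hint
    simpa only [neg_neg] using hint.neg

theorem exists_pow_succ_eq_sum {L : Type*} [CommRing L] {a : L} (ha : IsIntegral ℤ a) :
    ∃ (r : ℕ) (b : Fin (r + 1) → ℤ), a ^ (r + 1) = ∑ l, (b l : L) * a ^ (l : ℕ) := by
  obtain ⟨f, hf, hfa⟩ := ha
  have hroot : ∑ l ∈ Finset.range f.natDegree, (f.coeff l : L) * a ^ l + a ^ f.natDegree = 0 := by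
    simpa only [Polynomial.aeval_eq_sum_range, Finset.sum_range_succ, hf.coeff_natDegree,
      zsmul_eq_mul, Int.cast_one, one_mul] using (show Polynomial.aeval a f = 0 from hfa)
  refine ⟨f.natDegree, Fin.cons 0 fun l : Fin f.natDegree => -f.coeff l, ?_⟩
  rw [pow_succ, eq_neg_of_add_eq_zero_right hroot, neg_mul, Finset.sum_mul, Fin.sum_univ_succ,
    ← Fin.sum_univ_eq_sum_range (fun l => (f.coeff l : L) * a ^ l * a)]
  simp [pow_succ, mul_assoc]

theorem exists_pow_eq_sum_of_pow_succ_eq_sum {L : Type*} [CommRing L] {a : L} {r : ℕ}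
    {b : Fin (r + 1) → ℤ} (hb : a ^ (r + 1) = ∑ l, (b l : L) * a ^ (l : ℕ)) {B : ℤ}
    (hB : ∀ l, 1 + |b l| ≤ B) (k : ℕ) :
    ∃ A : Fin (r + 1) → ℤ, (∀ l, |A l| ≤ B ^ k) ∧ a ^ k = ∑ l, (A l : L) * a ^ (l : ℕ) := by
  have hB0 : 0 ≤ B := le_trans (by positivity) (hB 0)
  induction k with
  | zero =>
    refine ⟨Fin.cons 1 0, fun l => ?_, by simp [Fin.sum_univ_succ]⟩
    refine Fin.cases ?_ (fun l => ?_) l <;> simp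
  | succ k ih =>
    obtain ⟨A, hA, hAk⟩ := ih
    set A' : Fin (r + 1) → ℤ := Fin.cons 0 fun l => A l.castSucc
    have hA' (l) : |A' l| ≤ B ^ k := by
      refine Fin.cases ?_ (fun l => ?_) l
      · simpa [A'] using pow_nonneg hB0 k
      · simpa [A'] using hA l.castSucc
    refine ⟨fun l => A' l + A (Fin.last r) * b l, fun l => ?_, ?_⟩
    · calc |A' l + A (Fin.last r) * b l| ≤ |A' l| + |A (Fin.last r)| * |b l| := by
            rw [← abs_mul]; exact abs_add_le _ _
        _ ≤ B ^ k + B ^ k * |b l| := by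
            gcongr
            exacts [hA' l, hA _]
        _ = B ^ k * (1 + |b l|) := by ring
        _ ≤ B ^ k * B := by gcongr; exact hB l
        _ = B ^ (k + 1) := (pow_succ _ _).symm
    · have hshift : ∑ l, (A' l : L) * a ^ (l : ℕ) =
          ∑ l : Fin r, (A l.castSucc : L) * a ^ (l : ℕ) * a := by
        simp [A', Fin.sum_univ_succ, pow_succ, mul_assoc]
      calc a ^ (k + 1)
          = ∑ l : Fin r, (A l.castSucc : L) * a ^ (l : ℕ) * a + A (Fin.last r) * a ^ (r + 1) := by
            rw [pow_succ, hAk, Fin.sum_univ_castSucc, add_mul, Finset.sum_mul, mul_assoc,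
              Fin.val_last, ← pow_succ]
            rfl
        _ = ∑ l, (A' l : L) * a ^ (l : ℕ) +
              A (Fin.last r) * ∑ l, (b l : L) * a ^ (l : ℕ) := by rw [hshift, hb]
        _ = ∑ l, ((A' l + A (Fin.last r) * b l : ℤ) : L) * a ^ (l : ℕ) := by
            rw [Finset.mul_sum, ← Finset.sum_add_distrib]
            exact Finset.sum_congr rfl fun l _ => by push_cast; ring

theorem exists_forall_pow_eq_sum {L : Type*} [CommRing L] {a : L} (ha : IsIntegral ℤ a) :
    ∃ (r B : ℕ) (A : ℕ → Fin (r + 1) → ℤ), 1 ≤ B ∧ (∀ k l, |A k l| ≤ (B : ℤ) ^ k) ∧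
      ∀ k, a ^ k = ∑ l, (A k l : L) * a ^ (l : ℕ) := by
  obtain ⟨r, b, hb⟩ := exists_pow_succ_eq_sum ha
  have hB (l) : 1 + |b l| ≤ ((1 + ∑ l, (b l).natAbs : ℕ) : ℤ) := by
    rw [Int.abs_eq_natAbs]
    exact_mod_cast Nat.add_le_add_left
      (Finset.single_le_sum (f := fun l => (b l).natAbs) (by simp) (Finset.mem_univ l)) 1
  choose A hAle hA using exists_pow_eq_sum_of_pow_succ_eq_sum hb hB
  exact ⟨r, _, A, Nat.le_add_right 1 _, hAle, hA⟩

end IntegralPowers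

section AuxiliaryPolynomial

open MvPolynomial

theorem exists_int_mulVec_eq_zero_abs_le {ι κ : Type*} [Fintype ι] [Fintype κ] [Nonempty ι]
    (A : Matrix ι κ ℤ) (h : 2 * Fintype.card ι ≤ Fintype.card κ) {B : ℝ} (hB1 : 1 ≤ B)
    (hB : ∀ i j, |(A i j : ℝ)| ≤ B) :
    ∃ t : κ → ℤ, t ≠ 0 ∧ A.mulVec t = 0 ∧ ∀ j, |(t j : ℝ)| ≤ Fintype.card κ * B := by
  let _ : SeminormedAddCommGroup (Matrix ι κ ℤ) := Matrix.seminormedAddCommGroup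
  have h0 : 0 < Fintype.card ι := Fintype.card_pos
  obtain ⟨t, ht0, ht, hle⟩ := Int.Matrix.exists_ne_zero_int_vec_norm_le A (by omega) h0
  refine ⟨t, ht0, ht, fun j => ?_⟩
  have hA : ‖A‖ ≤ B := (Matrix.norm_le_iff (by linarith)).2 fun i j =>
    (Int.norm_eq_abs _).trans_le (hB i j)
  have hκ : (1 : ℝ) ≤ Fintype.card κ := Nat.one_le_cast.2 (by omega)
  have hικ : 2 * (Fintype.card ι : ℝ) ≤ Fintype.card κ := mod_cast h
  have hι : (0 : ℝ) < Fintype.card ι := Nat.cast_pos.2 h0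
  calc |(t j : ℝ)| = ‖t j‖ := (Int.norm_eq_abs _).symm
    _ ≤ ‖t‖ := norm_le_pi_norm t j
    _ ≤ _ := hle
    _ ≤ ((Fintype.card κ : ℝ) * max 1 ‖A‖) ^ (1 : ℝ) := by
        refine Real.rpow_le_rpow_of_exponent_le
          (one_le_mul_of_one_le_of_one_le hκ (le_max_left _ _)) ?_
        rw [div_le_one (by linarith)]
        linarith
    _ ≤ Fintype.card κ * B := by
        rw [Real.rpow_one]
        gcongr
        exact max_le hB1 hA

theorem sum_half_sub_div_eq_zero {d : ℕ} (hd : 0 < d) :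
    ∑ i : Fin (d + 1), (1 / 2 - ((i : ℕ) : ℝ) / d) = 0 := by
  have hgauss : (∑ i ∈ Finset.range (d + 1), (i : ℝ)) * 2 = (d + 1) * d := by
    have h := Finset.sum_range_id_mul_two (d + 1)
    rw [Nat.add_sub_cancel] at h
    have hcast := congrArg (Nat.cast (R := ℝ)) h
    push_cast at hcast
    exact hcast
  have : (d : ℝ) ≠ 0 := Nat.cast_ne_zero.2 hd.ne'
  rw [Finset.sum_sub_distrib, ← Finset.sum_div Finset.univ fun i : Fin (d + 1) => ((i : ℕ) : ℝ),
    Fin.sum_univ_eq_sum_range (fun i => (i : ℝ)),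
    eq_div_of_mul_eq two_ne_zero hgauss]
  simp
  field_simp
  ring

theorem sum_exp_half_sub_div_le {d : ℕ} (hd : 0 < d) {δ : ℝ} (hδ : 0 ≤ δ) (hδ1 : δ ≤ 1) :
    ∑ i : Fin (d + 1), Real.exp (2 * δ * (1 / 2 - (i : ℕ) / d)) ≤
      (d + 1) * Real.exp (δ ^ 2) := by
  have hd' : (0 : ℝ) < d := Nat.cast_pos.2 hd
  have hexp (i : Fin (d + 1)) : Real.exp (2 * δ * (1 / 2 - (i : ℕ) / d)) ≤
      1 + δ ^ 2 + 2 * δ * (1 / 2 - (i : ℕ) / d) := by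
    have hi0 : 0 ≤ ((i : ℕ) : ℝ) / d := by positivity
    have hi1 : ((i : ℕ) : ℝ) / d ≤ 1 :=
      (div_le_one hd').2 (Nat.cast_le.2 (Nat.lt_succ_iff.1 i.2))
    set y := 2 * δ * (1 / 2 - ((i : ℕ) : ℝ) / d) with hy_def
    have hy : |y| ≤ δ := by
      rw [abs_le]
      constructor <;> nlinarith
    have hquad := (abs_le.1 (Real.abs_exp_sub_one_sub_id_le (hy.trans hδ1))).2
    have hsq : y ^ 2 ≤ δ ^ 2 := sq_le_sq' (abs_le.1 hy).1 (abs_le.1 hy).2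
    linarith
  calc ∑ i : Fin (d + 1), Real.exp (2 * δ * (1 / 2 - (i : ℕ) / d))
      ≤ ∑ i : Fin (d + 1), (1 + δ ^ 2 + 2 * δ * (1 / 2 - (i : ℕ) / d)) :=
        Finset.sum_le_sum fun i _ => hexp i
    _ = (d + 1) * (1 + δ ^ 2) := by
        rw [Finset.sum_add_distrib, ← Finset.mul_sum, sum_half_sub_div_eq_zero hd]
        simp [mul_add]
    _ ≤ (d + 1) * Real.exp (δ ^ 2) := by
        gcongr
        linarith [Real.add_one_le_exp (δ ^ 2)]

variable {σ : Type*} {d : σ → ℕ}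

/-- The multi-exponents `e` with `e j ≤ d j` for all `j`. -/
abbrev Box (d : σ → ℕ) : Type _ := ∀ j, Fin (d j + 1)

variable [Fintype σ]

/-- A point of a box, viewed as the exponent of a monomial. -/
noncomputable def boxExponent (J : Box d) : σ →₀ ℕ :=
  Finsupp.equivFunOnFinite.symm fun j => (J j : ℕ)

@[simp]
theorem boxExponent_apply (J : Box d) (j : σ) : boxExponent J j = J j := rfl

theorem boxExponent_injective : Function.Injective (boxExponent (d := d)) := fun _ _ h =>
  funext fun j => Fin.ext (DFunLike.congr_fun h j)

theorem sum_boxExponent_le (J : Box d) : ∑ j, boxExponent J j ≤ ∑ j, d j :=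
  Finset.sum_le_sum fun j _ => Nat.lt_succ_iff.1 (J j).2

theorem card_box_le [DecidableEq σ] (d : σ → ℕ) : Fintype.card (Box d) ≤ 2 ^ ∑ j, d j := by
  rw [Fintype.card_pi, ← Finset.prod_pow_eq_pow_sum]
  exact Finset.prod_le_prod' fun j _ => (Fintype.card_fin _).trans_le Nat.lt_two_pow_self

/-- The points of a box whose index weight is less than `t`. -/
abbrev LowBox (d : σ → ℕ) (t : ℝ) : Type _ := {J : Box d // indexWeight d (boxExponent J) < t}

/- Chernoff's bound: the coordinates of a uniformly random point of the box, divided by the `d j`,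
are independent with mean `1 / 2`. -/
theorem card_lowBox_le [DecidableEq σ] (hd : ∀ j, 0 < d j) {δ : ℝ} (hδ : 0 < δ) (hδ1 : δ ≤ 1) :
    (Fintype.card (LowBox d (Fintype.card σ * (1 / 2 - δ))) : ℝ) ≤
      Real.exp (-(Fintype.card σ * δ ^ 2)) * Fintype.card (Box d) := by
  rw [Fintype.card_subtype]
  set m := Fintype.card σ
  set S := Finset.univ.filter fun J : Box d => indexWeight d (boxExponent J) < m * (1 / 2 - δ)
  have hS (J : Box d) (hJ : J ∈ S) :
      Real.exp (2 * (m * δ ^ 2)) ≤ ∏ j, Real.exp (2 * δ * (1 / 2 - (J j : ℕ) / d j)) := by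
    have hlt : ∑ j, ((J j : ℕ) : ℝ) / d j < m * (1 / 2 - δ) := (Finset.mem_filter.1 hJ).2
    rw [← Real.exp_sum, Real.exp_le_exp, ← Finset.mul_sum, Finset.sum_sub_distrib,
      Finset.sum_const, Finset.card_univ, nsmul_eq_mul]
    nlinarith
  have hmarkov : (S.card : ℝ) * Real.exp (2 * (m * δ ^ 2)) ≤
      Fintype.card (Box d) * Real.exp (m * δ ^ 2) := by
    calc (S.card : ℝ) * Real.exp (2 * (m * δ ^ 2))
        = ∑ _J ∈ S, Real.exp (2 * (m * δ ^ 2)) := by rw [Finset.sum_const, nsmul_eq_mul]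
      _ ≤ ∑ J ∈ S, ∏ j, Real.exp (2 * δ * (1 / 2 - (J j : ℕ) / d j)) := Finset.sum_le_sum hS
      _ ≤ ∑ J : Box d, ∏ j, Real.exp (2 * δ * (1 / 2 - (J j : ℕ) / d j)) :=
          Finset.sum_le_sum_of_subset_of_nonneg (Finset.subset_univ _) fun _ _ _ => by positivity
      _ = ∏ j, ∑ i : Fin (d j + 1), Real.exp (2 * δ * (1 / 2 - (i : ℕ) / d j)) := by
          rw [Finset.prod_univ_sum, Fintype.piFinset_univ]
      _ ≤ ∏ j, (((d j : ℝ) + 1) * Real.exp (δ ^ 2)) :=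
          Finset.prod_le_prod (fun _ _ => by positivity) fun j _ =>
            sum_exp_half_sub_div_le (hd j) hδ.le hδ1
      _ = Fintype.card (Box d) * Real.exp (m * δ ^ 2) := by
          rw [Finset.prod_mul_distrib, Finset.prod_const, Finset.card_univ, ← Real.exp_nat_mul]
          simp [Fintype.card_pi, m]
  rw [← mul_le_mul_iff_left₀ (Real.exp_pos (2 * (m * δ ^ 2)))]
  refine hmarkov.trans_eq ?_
  rw [mul_comm, mul_right_comm, ← Real.exp_add]
  ring_nf

/-- The polynomial with coefficient `t e` at each exponent `e` of a box. -/
noncomputable def boxPolynomial [DecidableEq σ] (t : Box d → ℤ) : MvPolynomial σ ℤ :=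
  ∑ e, monomial (boxExponent e) (t e)

section BoxPolynomial

variable [DecidableEq σ] (t : Box d → ℤ)

theorem coeff_boxPolynomial (e : Box d) : coeff (boxExponent e) (boxPolynomial t) = t e := by
  rw [boxPolynomial, coeff_sum, Finset.sum_eq_single e, coeff_monomial, if_pos rfl]
  · exact fun e' _ hne => by rw [coeff_monomial, if_neg (boxExponent_injective.ne hne)]
  · exact fun h => (h (Finset.mem_univ e)).elim

theorem boxPolynomial_ne_zero {t : Box d → ℤ} (ht : t ≠ 0) : boxPolynomial t ≠ 0 := by
  obtain ⟨e, he⟩ := Function.ne_iff.1 ht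
  exact fun h => he (by rw [← coeff_boxPolynomial t, h, coeff_zero]; rfl)

theorem degreeOf_boxPolynomial_le (j : σ) : degreeOf j (boxPolynomial t) ≤ d j := by
  refine (degreeOf_sum_le j _ _).trans (Finset.sup_le fun e _ => ?_)
  rw [degreeOf_le_iff]
  intro e' he'
  rw [Finset.mem_singleton.1 (support_monomial_subset he')]
  exact Nat.lt_succ_iff.1 (e j).2

theorem l1Norm_boxPolynomial_le {B : ℝ} (ht : ∀ e, |(t e : ℝ)| ≤ B) :
    l1Norm intAbv (boxPolynomial t) ≤ 2 ^ (∑ j, d j) * B := by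
  calc l1Norm intAbv (boxPolynomial t)
      ≤ ∑ e, l1Norm intAbv (monomial (boxExponent e) (t e)) := l1Norm_sum_le _ _ _
    _ ≤ ∑ _e : Box d, B := by
        refine Finset.sum_le_sum fun e _ => ?_
        rw [l1Norm_monomial, intAbv_apply]
        exact ht e
    _ = Fintype.card (Box d) * B := by rw [Finset.sum_const, nsmul_eq_mul, Finset.card_univ]
    _ ≤ 2 ^ (∑ j, d j) * B := by
        have : 0 ≤ B := (abs_nonneg _).trans (ht 0)
        gcongr
        exact_mod_cast card_box_le d

end BoxPolynomial

/-- Suppose that `(c * α) ^ q = ∑ l, A q l * (c * α) ^ l` for all `q`. For each multi-index `J`, the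
rows `(J, l)` of this integral matrix express `c ^ ∑ j, d j` times the Taylor coefficient of order
`J` at `(α, …, α)` of `boxPolynomial t` in terms of the powers `(c * α) ^ l`, linearly in `t`. The
truncated difference of degrees in it is only relevant for `J ≤ e`. -/
noncomputable def taylorMatrix {r : ℕ} (d : σ → ℕ) (c : ℕ) (A : ℕ → Fin (r + 1) → ℤ) :
    Matrix ((σ →₀ ℕ) × Fin (r + 1)) (Box d) ℤ :=
  Matrix.of fun i e =>
    let q := ∑ j, boxExponent e j - ∑ j, i.1 j
    multiBinom (boxExponent e) i.1 * (c ^ (∑ j, d j - q) * A q i.2)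

section TaylorMatrix

variable {r c B : ℕ} {A : ℕ → Fin (r + 1) → ℤ}

theorem abs_taylorMatrix_le (d : σ → ℕ) (hc : c ≠ 0) (hB : 1 ≤ B)
    (hA : ∀ q l, |A q l| ≤ (B : ℤ) ^ q) (i : (σ →₀ ℕ) × Fin (r + 1)) (e : Box d) :
    |(taylorMatrix d c A i e : ℝ)| ≤ ((2 * c * B : ℕ) : ℝ) ^ ∑ j, d j := by
  set D := ∑ j, d j
  set q := ∑ j, boxExponent e j - ∑ j, i.1 j
  have heD : ∑ j, boxExponent e j ≤ D := sum_boxExponent_le e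
  have hqD : q ≤ D := (Nat.sub_le _ _).trans heD
  have hbinom : (multiBinom (boxExponent e) i.1 : ℤ) ≤ 2 ^ D :=
    mod_cast (multiBinom_le_two_pow _ _).trans (Nat.pow_le_pow_right two_pos heD)
  have hcpow : (c : ℤ) ^ (D - q) ≤ (c : ℤ) ^ D :=
    pow_le_pow_right₀ (mod_cast Nat.one_le_iff_ne_zero.2 hc) (Nat.sub_le _ _)
  have hAB : |A q i.2| ≤ (B : ℤ) ^ D :=
    (hA q i.2).trans (pow_le_pow_right₀ (mod_cast hB) hqD)
  have hint : |taylorMatrix d c A i e| ≤ ((2 * c * B : ℕ) : ℤ) ^ D := by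
    calc |taylorMatrix d c A i e|
        = multiBinom (boxExponent e) i.1 * ((c : ℤ) ^ (D - q) * |A q i.2|) := by
          rw [taylorMatrix, Matrix.of_apply, abs_mul, abs_mul, Nat.abs_cast, abs_pow, Nat.abs_cast]
      _ ≤ 2 ^ D * ((c : ℤ) ^ D * (B : ℤ) ^ D) := by gcongr
      _ = ((2 * c * B : ℕ) : ℤ) ^ D := by push_cast; ring
  exact_mod_cast hint

theorem pow_mul_coeff_taylor_boxPolynomial [DecidableEq σ] {L : Type*} [CommRing L] {α : L}
    (hA : ∀ q, ((c : L) * α) ^ q = ∑ l, (A q l : L) * ((c : L) * α) ^ (l : ℕ))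
    (t : Box d → ℤ) (J : σ →₀ ℕ) :
    (c : L) ^ (∑ j, d j) * coeff J (taylor (fun _ => α) (boxPolynomial t)) =
      ∑ l, ((taylorMatrix d c A).mulVec t (J, l) : L) * ((c : L) * α) ^ (l : ℕ) := by
  simp only [boxPolynomial, map_sum, coeff_sum, Finset.mul_sum, Matrix.mulVec, dotProduct,
    Int.cast_sum, Int.cast_mul, Finset.sum_mul]
  rw [Finset.sum_comm]
  refine Finset.sum_congr rfl fun e _ => ?_
  simp only [taylorMatrix, Matrix.of_apply, coeff_taylor_monomial, Finset.prod_pow_eq_pow_sum]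
  by_cases hJ : J ≤ boxExponent e
  · rw [Finset.sum_tsub_distrib _ fun j _ => hJ j]
    set q := ∑ j, boxExponent e j - ∑ j, J j
    have hq : q ≤ ∑ j, d j := (Nat.sub_le _ _).trans (sum_boxExponent_le e)
    have hsplit : (c : L) ^ (∑ j, d j) * α ^ q =
        c ^ (∑ j, d j - q) * ∑ l, (A q l : L) * ((c : L) * α) ^ (l : ℕ) := by
      rw [← hA, mul_pow, ← mul_assoc, ← pow_add, Nat.sub_add_cancel hq]
    calc (c : L) ^ (∑ j, d j) * (algebraMap ℤ L (t e) *
          ((multiBinom (boxExponent e) J : L) * α ^ q))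
        = (multiBinom (boxExponent e) J : L) * t e * ((c : L) ^ (∑ j, d j) * α ^ q) := by
          rw [algebraMap_int_eq, eq_intCast]; ring
      _ = _ := by
          rw [hsplit, Finset.mul_sum, Finset.mul_sum]
          exact Finset.sum_congr rfl fun l _ => by push_cast; ring
  · simp [multiBinom_eq_zero hJ]

end TaylorMatrix

theorem two_mul_card_lowBox_prod_le [DecidableEq σ] (hd : ∀ j, 0 < d j) {δ : ℝ} (hδ : 0 < δ)
    (hδ1 : δ ≤ 1) {r : ℕ} (hr : 2 * r * Real.exp (-(Fintype.card σ * δ ^ 2)) ≤ 1) :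
    2 * Fintype.card (LowBox d (Fintype.card σ * (1 / 2 - δ)) × Fin r) ≤ Fintype.card (Box d) := by
  rw [Fintype.card_prod, Fintype.card_fin, ← Nat.cast_le (α := ℝ)]
  set m := Fintype.card σ
  calc ((2 * (Fintype.card (LowBox d (m * (1 / 2 - δ))) * r) : ℕ) : ℝ)
      = 2 * r * Fintype.card (LowBox d (m * (1 / 2 - δ))) := by push_cast; ring
    _ ≤ 2 * r * (Real.exp (-(m * δ ^ 2)) * Fintype.card (Box d)) := by
        gcongr
        exact card_lowBox_le hd hδ hδ1
    _ = (2 * r * Real.exp (-(m * δ ^ 2))) * Fintype.card (Box d) := by ring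
    _ ≤ Fintype.card (Box d) := mul_le_of_le_one_left (Nat.cast_nonneg _) hr

theorem orderGE_taylor_boxPolynomial [DecidableEq σ] {L : Type*} [CommRing L] {t : Box d → ℤ}
    {a : σ → L} {s : ℝ}
    (h : ∀ J : LowBox d s, coeff (boxExponent J.1) (taylor a (boxPolynomial t)) = 0) :
    OrderGE (indexWeight d) s (taylor a (boxPolynomial t)) := by
  intro J hJ
  by_contra! hlt
  have hJd (j) : J j < d j + 1 := Nat.lt_succ_iff.2 <| degreeOf_le_iff.1
    ((degreeOf_taylor_le _ _ j).trans (degreeOf_boxPolynomial_le t j)) J (mem_support_iff.2 hJ)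
  have hJJ : boxExponent (d := d) (fun j => ⟨J j, hJd j⟩) = J := by ext j; rfl
  exact hJ (hJJ ▸ h ⟨_, hJJ.symm ▸ hlt⟩)

theorem exists_orderGE_taylor_of_pow_eq_sum [Nonempty σ] {L : Type*} [CommRing L]
    [NoZeroDivisors L] [CharZero L] {α : L} {r c B : ℕ} {A : ℕ → Fin (r + 1) → ℤ} (hc : c ≠ 0)
    (hA : ∀ q, ((c : L) * α) ^ q = ∑ l, (A q l : L) * ((c : L) * α) ^ (l : ℕ)) (hB : 1 ≤ B)
    (hAB : ∀ q l, |A q l| ≤ (B : ℤ) ^ q) {δ : ℝ} (hδ : 0 < δ) (hδ1 : δ < 1 / 2)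
    (hr : 2 * ((r + 1 : ℕ) : ℝ) * Real.exp (-(Fintype.card σ * δ ^ 2)) ≤ 1) (hd : ∀ j, 0 < d j) :
    ∃ P : MvPolynomial σ ℤ, P ≠ 0 ∧ (∀ j, degreeOf j P ≤ d j) ∧
      l1Norm intAbv P ≤ ((8 * c * B : ℕ) : ℝ) ^ (∑ j, d j) ∧
      OrderGE (indexWeight d) (Fintype.card σ * (1 / 2 - δ)) (taylor (fun _ => α) P) := by
  classical
  have : Nonempty (LowBox d (Fintype.card σ * (1 / 2 - δ))) := by
    have : (0 : ℝ) < Fintype.card σ * (1 / 2 - δ) :=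
      mul_pos (Nat.cast_pos.2 Fintype.card_pos) (by linarith)
    exact ⟨0, by simpa [indexWeight_apply] using this⟩
  have hcB : 1 ≤ ((2 * c * B : ℕ) : ℝ) :=
    Nat.one_le_cast.2 (Nat.one_le_iff_ne_zero.2 (by positivity))
  obtain ⟨t, ht0, ht, htle⟩ := exists_int_mulVec_eq_zero_abs_le
    ((taylorMatrix d c A).submatrix
      (fun i : LowBox d _ × Fin (r + 1) => (boxExponent i.1.1, i.2)) id)
    (two_mul_card_lowBox_prod_le hd hδ (by linarith) hr) (one_le_pow₀ hcB)
    fun i e => abs_taylorMatrix_le d hc hB hAB _ e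
  refine ⟨boxPolynomial t, boxPolynomial_ne_zero ht0, degreeOf_boxPolynomial_le t, ?_,
    orderGE_taylor_boxPolynomial fun J => ?_⟩
  · refine (l1Norm_boxPolynomial_le t htle).trans ?_
    have hbox : (Fintype.card (Box d) : ℝ) ≤ 2 ^ ∑ j, d j := mod_cast card_box_le d
    calc (2 : ℝ) ^ (∑ j, d j) * (Fintype.card (Box d) * ((2 * c * B : ℕ) : ℝ) ^ ∑ j, d j)
        ≤ 2 ^ (∑ j, d j) * (2 ^ (∑ j, d j) * ((2 * c * B : ℕ) : ℝ) ^ ∑ j, d j) := by gcongr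
      _ = ((8 * c * B : ℕ) : ℝ) ^ ∑ j, d j := by
          rw [← mul_pow, ← mul_pow]
          push_cast
          ring_nf
  · have h := pow_mul_coeff_taylor_boxPolynomial hA t (boxExponent J.1)
    have hrow (l) : (taylorMatrix d c A).mulVec t (boxExponent J.1, l) = 0 := congrFun ht (J, l)
    simp only [hrow, Int.cast_zero, zero_mul, Finset.sum_const_zero] at h
    exact (mul_eq_zero.1 h).resolve_left (pow_ne_zero _ (Nat.cast_ne_zero.2 hc))

theorem exists_auxiliary_polynomial {L : Type*} [CommRing L] [NoZeroDivisors L] [CharZero L]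
    {α : L} (hα : IsAlgebraic ℤ α) {δ : ℝ} (hδ : 0 < δ) (hδ1 : δ < 1 / 2) :
    ∃ (m : ℕ) (C : ℝ), 0 < m ∧ 1 ≤ C ∧ ∀ d : Fin m → ℕ, (∀ j, 0 < d j) →
      ∃ P : MvPolynomial (Fin m) ℤ, P ≠ 0 ∧ (∀ j, degreeOf j P ≤ d j) ∧
        l1Norm intAbv P ≤ C ^ (∑ j, d j) ∧
        OrderGE (indexWeight d) (m * (1 / 2 - δ)) (taylor (fun _ => α) P) := by
  obtain ⟨c, hc, hint⟩ := exists_natCast_mul_isIntegral hα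
  obtain ⟨r, B, A, hB, hAB, hA⟩ := exists_forall_pow_eq_sum hint
  have hr1 : (1 : ℝ) ≤ (r + 1 : ℕ) := Nat.one_le_cast.2 (Nat.le_add_left 1 r)
  obtain ⟨m, hm⟩ := exists_nat_gt (Real.log (2 * (r + 1 : ℕ)) / δ ^ 2)
  have hm0 : 0 < m := Nat.cast_pos.1 <|
    (div_nonneg (Real.log_nonneg (by linarith)) (sq_nonneg δ)).trans_lt hm
  have hexp : 2 * ((r + 1 : ℕ) : ℝ) * Real.exp (-(Fintype.card (Fin m) * δ ^ 2)) ≤ 1 := by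
    rw [div_lt_iff₀ (by positivity), Real.log_lt_iff_lt_exp (by positivity)] at hm
    rw [Fintype.card_fin, Real.exp_neg, ← div_eq_mul_inv]
    exact (div_le_one (Real.exp_pos _)).2 hm.le
  have : Nonempty (Fin m) := ⟨⟨0, hm0⟩⟩
  have hcB : 8 * c * B ≠ 0 := by positivity
  refine ⟨m, (8 * c * B : ℕ), hm0, Nat.one_le_cast.2 (Nat.one_le_iff_ne_zero.2 hcB),
    fun d hd => ?_⟩
  simpa only [Fintype.card_fin] using
    exists_orderGE_taylor_of_pow_eq_sum hc hA hB hAB hδ hδ1 hexp hd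

end AuxiliaryPolynomial

section Place

open NumberField Height

variable {K : Type*} [Field K]

/-- The power `w ^ p` of an absolute value `w` with exponent `0 < p ≤ 1`, which is again an
absolute value. It is used to normalize the absolute values of a number field. -/
noncomputable def abvRpow (w : AbsoluteValue K ℝ) {p : ℝ} (hp0 : 0 < p) (hp1 : p ≤ 1) :
    AbsoluteValue K ℝ where
  toFun x := w x ^ p
  map_mul' x y := by rw [map_mul, Real.mul_rpow (w.nonneg x) (w.nonneg y)]
  nonneg' x := Real.rpow_nonneg (w.nonneg x) p
  eq_zero' x := by rw [Real.rpow_eq_zero (w.nonneg x) hp0.ne', w.eq_zero]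
  add_le' x y := (Real.rpow_le_rpow (w.nonneg _) (w.add_le x y) hp0.le).trans
    (Real.rpow_add_le_add_rpow (w.nonneg x) (w.nonneg y) hp0.le hp1)

theorem isNonarchimedean_abvRpow {w : AbsoluteValue K ℝ} (hw : IsNonarchimedean w) {p : ℝ}
    (hp0 : 0 < p) (hp1 : p ≤ 1) : IsNonarchimedean (abvRpow w hp0 hp1) := fun x y =>
  (Real.rpow_le_rpow (w.nonneg _) (hw x y) hp0.le).trans_eq
    (Real.rpow_max (w.nonneg x) (w.nonneg y) hp0.le)

variable [NumberField K]

theorem finrank_pos_real : (0 : ℝ) < (Module.finrank ℚ K : ℝ) :=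
  Nat.cast_pos.2 Module.finrank_pos

theorem one_le_finrank_real : (1 : ℝ) ≤ (Module.finrank ℚ K : ℝ) :=
  Nat.one_le_cast.2 Module.finrank_pos

theorem mult_le_finrank (v : InfinitePlace K) : v.mult ≤ Module.finrank ℚ K := by
  rw [← InfinitePlace.sum_mult_eq (K := K)]
  exact Finset.single_le_sum (f := fun v : InfinitePlace K => v.mult) (fun _ _ => Nat.zero_le _)
    (Finset.mem_univ v)

/-- The normalized absolute value `normAbs v`, bundled as an absolute value of `K`. -/
noncomputable def placeAbv : Place K → AbsoluteValue K ℝ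
  | .inl v => abvRpow v.1 (div_pos (Nat.cast_pos.2 v.mult_pos) (finrank_pos_real (K := K)))
      (div_le_one_of_le₀ (Nat.cast_le.2 (mult_le_finrank v)) (Nat.cast_nonneg _))
  | .inr v => abvRpow v.1 (one_div_pos.2 (finrank_pos_real (K := K)))
      (div_le_one_of_le₀ one_le_finrank_real (Nat.cast_nonneg _))

theorem placeAbv_apply (v : Place K) (x : K) : placeAbv v x = normAbs v x := by
  cases v <;> rfl

theorem isNonarchimedean_placeAbv_inr (v : FinitePlace K) :
    IsNonarchimedean (placeAbv (.inr v : Place K)) :=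
  isNonarchimedean_abvRpow (w := v.1) (FinitePlace.add_le v)
    (one_div_pos.2 finrank_pos_real) (div_le_one_of_le₀ one_le_finrank_real (Nat.cast_nonneg _))

theorem normAbs_nonneg (v : Place K) (x : K) : 0 ≤ normAbs v x :=
  (placeAbv v).nonneg x |>.trans_eq (placeAbv_apply v x)

theorem finprod_place (f : Place K → ℝ) (hf : f.HasFiniteMulSupport) :
    ∏ᶠ v, f v = (∏ v : InfinitePlace K, f (.inl v)) * ∏ᶠ v : FinitePlace K, f (.inr v) := by
  rw [← finprod_mem_univ, ← Set.range_inl_union_range_inr,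
    finprod_mem_union' Set.isCompl_range_inl_range_inr.disjoint
      (Set.Finite.inter_of_right hf _) (Set.Finite.inter_of_right hf _),
    finprod_mem_range Sum.inl_injective, finprod_mem_range Sum.inr_injective,
    finprod_eq_prod_of_fintype]

theorem rpow_div_finrank_pow_finrank {x : ℝ} (hx : 0 ≤ x) (n : ℕ) :
    (x ^ ((n : ℝ) / (Module.finrank ℚ K : ℝ))) ^ Module.finrank ℚ K = x ^ n := by
  rw [← Real.rpow_natCast, ← Real.rpow_mul hx, div_mul_cancel₀ _ finrank_pos_real.ne',
    Real.rpow_natCast]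

theorem normAbs_inl_pow_finrank (v : InfinitePlace K) (x : K) :
    normAbs (.inl v) x ^ Module.finrank ℚ K = v x ^ v.mult :=
  rpow_div_finrank_pow_finrank (apply_nonneg v x) _

theorem normAbs_inr_pow_finrank (v : FinitePlace K) (x : K) :
    normAbs (.inr v) x ^ Module.finrank ℚ K = v x := by
  simpa [normAbs] using rpow_div_finrank_pow_finrank (K := K) (apply_nonneg v x) 1

theorem hasFiniteMulSupport_normAbs {x : K} (hx : x ≠ 0) :
    (fun v : Place K => normAbs v x).HasFiniteMulSupport := by
  refine ((Set.finite_range (Sum.inl : InfinitePlace K → Place K)).union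
    (Set.Finite.image Sum.inr (FinitePlace.hasFiniteMulSupport hx))).subset ?_
  rintro (v | v) hv
  · exact Or.inl ⟨v, rfl⟩
  · refine Or.inr ⟨v, fun hvx : v x = 1 => hv ?_, rfl⟩
    simp [normAbs, hvx]

theorem finprod_normAbs_eq_one {x : K} (hx : x ≠ 0) : ∏ᶠ v : Place K, normAbs v x = 1 := by
  have hf := hasFiniteMulSupport_normAbs hx
  refine (pow_eq_one_iff_of_nonneg (finprod_nonneg fun v => normAbs_nonneg v x)
    (Module.finrank_pos (R := ℚ) (M := K)).ne').1 ?_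
  have hpow := finprod_place (fun v : Place K => normAbs v x ^ Module.finrank ℚ K) (hf.pow _)
  rw [finprod_pow hf, hpow, ← prod_abs_eq_one hx]
  simp only [normAbs_inl_pow_finrank, normAbs_inr_pow_finrank]

theorem max_one_pow {x : ℝ} (hx : 0 ≤ x) (n : ℕ) : max 1 x ^ n = max 1 (x ^ n) := by
  rw [(pow_left_monotoneOn (n := n)).map_max (Set.mem_Ici.2 zero_le_one) hx, one_pow]

theorem height_pow_finrank (x : K) : height x ^ Module.finrank ℚ K = mulHeight₁ x := by
  have hf : (fun v : Place K => max 1 (normAbs v x)).HasFiniteMulSupport :=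
    height_finite_mulSupport x
  have hpow := finprod_place (fun v : Place K => max 1 (normAbs v x) ^ Module.finrank ℚ K)
    (hf.pow _)
  rw [height, finprod_pow hf, hpow, NumberField.mulHeight₁_eq]
  simp only [max_one_pow (normAbs_nonneg _ x), normAbs_inl_pow_finrank, normAbs_inr_pow_finrank,
    max_comm _ (1 : ℝ), max_one_pow (apply_nonneg _ x)]

theorem one_le_height (x : K) : 1 ≤ height x :=
  one_le_finprod fun _ => le_max_left _ _

theorem height_pos (x : K) : 0 < height x :=
  one_pos.trans_le (one_le_height x)

theorem log_height_nonneg (x : K) : 0 ≤ Real.log (height x) :=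
  Real.log_nonneg (one_le_height x)

theorem finrank_mul_log_height (x : K) :
    Module.finrank ℚ K * Real.log (height x) = logHeight₁ x := by
  rw [← Real.log_pow, height_pow_finrank, logHeight₁_eq_log_mulHeight₁]

theorem log_height_le_logHeight₁ (x : K) : Real.log (height x) ≤ logHeight₁ x :=
  (le_mul_of_one_le_left (log_height_nonneg x) one_le_finrank_real).trans_eq
    (finrank_mul_log_height x)

theorem finite_log_height_le (B : ℝ) : {x : K | Real.log (height x) ≤ B}.Finite := by
  refine (finite_setOfPred_logHeight₁_le (K := K) (Module.finrank ℚ K * B)).subset fun x hx => ?_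
  change logHeight₁ x ≤ _
  rw [← finrank_mul_log_height]
  exact mul_le_mul_of_nonneg_left hx finrank_pos_real.le

theorem exists_le_log_height {Y : Set K} (hY : Y.Infinite) (T : ℝ) :
    ∃ x ∈ Y, T ≤ Real.log (height x) := by
  obtain ⟨x, hx, hxT⟩ := (hY.sdiff (finite_log_height_le T)).nonempty
  exact ⟨x, hx, (not_le.1 hxT).le⟩

theorem one_le_prod_mul_finprod {y : K} (hy : y ≠ 0) {T : Finset (Place K)} {b H : Place K → ℝ}
    (hH : H.HasFiniteMulSupport) (hT : ∀ v ∈ T, normAbs v y ≤ b v * H v)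
    (hTc : ∀ v ∉ T, normAbs v y ≤ H v) : 1 ≤ (∏ v ∈ T, b v) * ∏ᶠ v, H v := by
  classical
  set B : Place K → ℝ := fun v => if v ∈ T then b v else 1
  have hBT : Function.mulSupport B ⊆ (T : Set (Place K)) := fun v hv => by
    by_contra h
    exact hv (if_neg h)
  have hB : B.HasFiniteMulSupport := T.finite_toSet.subset hBT
  have hprod : ∏ᶠ v, B v = ∏ v ∈ T, b v := by
    rw [finprod_eq_prod_of_mulSupport_subset _ hBT]
    exact Finset.prod_congr rfl fun v hv => if_pos hv
  rw [← finprod_normAbs_eq_one hy, ← hprod, ← finprod_mul_distrib hB hH]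
  refine finprod_le_finprod (hasFiniteMulSupport_normAbs hy) (fun v => normAbs_nonneg v y)
    (hB.mul hH) fun v => ?_
  by_cases hv : v ∈ T
  · simpa only [B, if_pos hv] using hT v hv
  · simpa only [B, if_neg hv, one_mul] using hTc v hv

variable {ι : Type*} (x : ι → K) (d : ι → ℕ)

theorem hasFiniteMulSupport_max_one_normAbs_pow (j : ι) :
    (fun v : Place K => max 1 (normAbs v (x j)) ^ d j).HasFiniteMulSupport :=
  Function.HasFiniteMulSupport.pow (f := fun v : Place K => max 1 (normAbs v (x j)))
    (height_finite_mulSupport (x j)) (d j)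

theorem finprod_prod_max_one_normAbs_pow [Fintype ι] :
    ∏ᶠ v : Place K, ∏ j, max 1 (normAbs v (x j)) ^ d j = ∏ j, height (x j) ^ d j := by
  rw [finprod_prod_comm _ _ fun j _ => hasFiniteMulSupport_max_one_normAbs_pow x d j]
  refine Finset.prod_congr rfl fun j _ => ?_
  rw [height, finprod_pow (height_finite_mulSupport (x j))]

end Place

section ProductFormula

open MvPolynomial NumberField

variable {σ : Type*} [Fintype σ] {d : σ → ℕ} {Q : MvPolynomial σ ℤ}

theorem prod_pow_le_prod_max_one_pow {y : σ → ℝ} (hy : ∀ j, 0 ≤ y j) {e : σ → ℕ}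
    (he : ∀ j, e j ≤ d j) : ∏ j, y j ^ e j ≤ ∏ j, max 1 (y j) ^ d j := by
  refine Finset.prod_le_prod (fun j _ => pow_nonneg (hy j) _) fun j _ => ?_
  exact (pow_le_pow_left₀ (hy j) (le_max_right _ _) _).trans
    (pow_le_pow_right₀ (le_max_left _ _) (he j))

section Local

variable {A : Type*} [Field A] {w : AbsoluteValue A ℝ}

theorem abv_aeval_le (w : AbsoluteValue A ℝ) (x : σ → A) (hd : ∀ j, degreeOf j Q ≤ d j) :
    w (aeval x Q) ≤ l1Norm intAbv Q * ∏ j, max 1 (w (x j)) ^ d j := by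
  rw [aeval_def, eval₂_eq', l1Norm, Finset.sum_mul]
  refine (w.sum_le _ _).trans (Finset.sum_le_sum fun e he => ?_)
  rw [map_mul, map_prod, eq_intCast]
  simp only [map_pow]
  exact mul_le_mul (abv_intCast_le_intAbv w _) (prod_pow_le_prod_max_one_pow
    (fun j => w.nonneg _) fun j => degreeOf_le_iff.1 (hd j) e he)
    (Finset.prod_nonneg fun j _ => pow_nonneg (w.nonneg _) _) (intAbv.nonneg _)

theorem abv_aeval_le_of_isNonarchimedean (hw : IsNonarchimedean w) (x : σ → A)
    (hd : ∀ j, degreeOf j Q ≤ d j) : w (aeval x Q) ≤ ∏ j, max 1 (w (x j)) ^ d j := by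
  rw [aeval_def, eval₂_eq']
  rcases Q.support.eq_empty_or_nonempty with hQ | hQ
  · rw [hQ, Finset.sum_empty, map_zero]
    exact Finset.prod_nonneg fun j _ => by positivity
  refine (hw.apply_sum_le_sup hQ).trans (Finset.sup'_le _ _ fun e he => ?_)
  rw [map_mul, map_prod, eq_intCast]
  simp only [map_pow]
  exact (mul_le_of_le_one_left (Finset.prod_nonneg fun j _ => pow_nonneg (w.nonneg _) _)
    hw.apply_intCast_le_one).trans (prod_pow_le_prod_max_one_pow (fun j => w.nonneg _)
      fun j => degreeOf_le_iff.1 (hd j) e he)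

theorem max_one_abv_sub_le (w : AbsoluteValue A ℝ) (x α : A) :
    max 1 (w (x - α)) ≤ (1 + w α) * max 1 (w x) := by
  have hsub : w (x - α) ≤ w x + w α := by
    simpa only [sub_eq_add_neg, w.map_neg] using w.add_le x (-α)
  have hα := w.nonneg α
  have h1 : 1 ≤ max 1 (w x) := le_max_left _ _
  have hx : w x ≤ max 1 (w x) := le_max_right _ _
  refine max_le ?_ ?_ <;> nlinarith

theorem abv_sub_pow_le (w : AbsoluteValue A ℝ) (x α : A) {k n : ℕ} (hkn : k ≤ n) :
    w (x - α) ^ k ≤ min 1 (w (x - α)) ^ k * ((1 + w α) ^ n * max 1 (w x) ^ n) :=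
  calc w (x - α) ^ k = min 1 (w (x - α)) ^ k * max 1 (w (x - α)) ^ k := by
        rw [← mul_pow, min_mul_max, one_mul]
    _ ≤ min 1 (w (x - α)) ^ k * ((1 + w α) * max 1 (w x)) ^ n := by
        refine mul_le_mul_of_nonneg_left ?_ (pow_nonneg (le_min zero_le_one (w.nonneg _)) _)
        exact (pow_le_pow_right₀ (le_max_left _ _) hkn).trans
          (pow_le_pow_left₀ (by positivity) (max_one_abv_sub_le w x α) _)
    _ = _ := by rw [mul_pow]

theorem prod_abv_sub_pow_le (w : AbsoluteValue A ℝ) (x : σ → A) (α : A) {e : σ → ℕ}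
    (he : ∀ j, e j ≤ d j) :
    ∏ j, w (x j - α) ^ e j ≤ (∏ j, min 1 (w (x j - α)) ^ e j) *
      ((1 + w α) ^ (∑ j, d j) * ∏ j, max 1 (w (x j)) ^ d j) := by
  rw [← Finset.prod_pow_eq_pow_sum, ← Finset.prod_mul_distrib, ← Finset.prod_mul_distrib]
  exact Finset.prod_le_prod (fun j _ => pow_nonneg (w.nonneg _) _)
    fun j _ => abv_sub_pow_le w (x j) α (he j)

theorem abv_aeval_le_of_orderGE (w : AbsoluteValue A ℝ) (x : σ → A) {α : A}
    (hd : ∀ j, degreeOf j Q ≤ d j) {ω : (σ →₀ ℕ) →+ ℝ} {t E : ℝ}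
    (ht : OrderGE ω t (taylor (fun _ => α) Q)) (hE0 : 0 ≤ E)
    (hE : ∀ e : σ →₀ ℕ, t ≤ ω e → ∏ j, min 1 (w (x j - α)) ^ e j ≤ E) :
    w (aeval x Q) ≤
      l1Norm intAbv Q * ((1 + w α) ^ (2 * ∑ j, d j) * E) * ∏ j, max 1 (w (x j)) ^ d j := by
  have hα : 0 ≤ w α := w.nonneg α
  set D := ∑ j, d j
  set M := ∏ j, max 1 (w (x j)) ^ d j
  have : 0 ≤ M := Finset.prod_nonneg fun j _ => by positivity
  set T := taylor (fun _ => α) Q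
  have hterm (e : σ →₀ ℕ) (he : e ∈ T.support) :
      ∏ j, w (x j - α) ^ e j ≤ E * ((1 + w α) ^ D * M) :=
    (prod_abv_sub_pow_le w x α fun j => degreeOf_le_iff.1
      ((degreeOf_taylor_le Q _ j).trans (hd j)) e he).trans
      (mul_le_mul_of_nonneg_right (hE e (ht e (mem_support_iff.1 he))) (by positivity))
  have hT : l1Norm w T ≤ l1Norm intAbv Q * (1 + w α) ^ D :=
    l1Norm_taylor_le intAbv (abv_intCast_le_intAbv w) hd (by linarith) fun _ => le_rfl
  rw [aeval_eq_sum_coeff_taylor (fun _ => α) x Q]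
  calc w (∑ e ∈ T.support, coeff e T * ∏ j, (x j - α) ^ e j)
      ≤ ∑ e ∈ T.support, w (coeff e T) * (E * ((1 + w α) ^ D * M)) := by
        refine (w.sum_le _ _).trans (Finset.sum_le_sum fun e he => ?_)
        rw [map_mul, map_prod]
        simp only [map_pow]
        exact mul_le_mul_of_nonneg_left (hterm e he) (w.nonneg _)
    _ = l1Norm w T * (E * ((1 + w α) ^ D * M)) := by rw [l1Norm, Finset.sum_mul]
    _ ≤ (l1Norm intAbv Q * (1 + w α) ^ D) * (E * ((1 + w α) ^ D * M)) :=
        mul_le_mul_of_nonneg_right hT (by positivity)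
    _ = _ := by rw [two_mul, pow_add]; ring

end Local

variable {K : Type*} [Field K] [NumberField K]

theorem normAbs_aeval_le (v : Place K) (x : σ → K) (hd : ∀ j, degreeOf j Q ≤ d j) :
    normAbs v (aeval x Q) ≤ l1Norm intAbv Q * ∏ j, max 1 (normAbs v (x j)) ^ d j := by
  simpa only [placeAbv_apply] using abv_aeval_le (placeAbv v) x hd

theorem normAbs_inr_aeval_le (v : FinitePlace K) (x : σ → K) (hd : ∀ j, degreeOf j Q ≤ d j) :
    normAbs (.inr v) (aeval x Q) ≤ ∏ j, max 1 (normAbs (.inr v) (x j)) ^ d j := by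
  simpa only [placeAbv_apply] using
    abv_aeval_le_of_isNonarchimedean (isNonarchimedean_placeAbv_inr v) x hd

variable {L : Type*} [Field L] [Algebra K L]

theorem normAbs_aeval_le_of_orderGE {w : AbsoluteValue L ℝ} {v : Place K} (hw : Extends w v)
    (x : σ → K) {α : L} (hd : ∀ j, degreeOf j Q ≤ d j) {ω : (σ →₀ ℕ) →+ ℝ} {t E : ℝ}
    (ht : OrderGE ω t (taylor (fun _ => α) Q)) (hE0 : 0 ≤ E)
    (hE : ∀ e : σ →₀ ℕ, t ≤ ω e → ∏ j, min 1 (w (algebraMap K L (x j) - α)) ^ e j ≤ E) :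
    normAbs v (aeval x Q) ≤
      l1Norm intAbv Q * ((1 + w α) ^ (2 * ∑ j, d j) * E) * ∏ j, max 1 (normAbs v (x j)) ^ d j := by
  have h := abv_aeval_le_of_orderGE w (fun j => algebraMap K L (x j)) hd ht hE0 hE
  have haeval : aeval (fun j => algebraMap K L (x j)) Q = algebraMap K L (aeval x Q) :=
    aeval_algebraMap_apply L x Q
  rw [haeval, hw] at h
  simpa only [hw _] using h

theorem one_le_of_aeval_ne_zero (S : Finset (Place K)) (w : Place K → AbsoluteValue L ℝ)
    (hw : ∀ v ∈ S, Extends (w v) v) {α : L} {x : σ → K} (hd : ∀ j, degreeOf j Q ≤ d j)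
    (hx : aeval x Q ≠ 0) {ω : (σ →₀ ℕ) →+ ℝ} {t : ℝ} {E : Place K → ℝ}
    (ht : OrderGE ω t (taylor (fun _ => α) Q)) (hE0 : ∀ v ∈ S, 0 ≤ E v)
    (hE : ∀ v ∈ S, ∀ e : σ →₀ ℕ, t ≤ ω e →
      ∏ j, min 1 (w v (algebraMap K L (x j) - α)) ^ e j ≤ E v) :
    1 ≤ l1Norm intAbv Q ^ (S.card + Fintype.card (InfinitePlace K)) *
      (∏ v ∈ S, ((1 + w v α) ^ (2 * ∑ j, d j) * E v)) * ∏ j, height (x j) ^ d j := by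
  classical
  have hQ : Q ≠ 0 := fun h => hx (by rw [h, map_zero])
  set T : Finset (Place K) := S ∪ Finset.univ.image Sum.inl
  set c : Place K → ℝ := fun v => (1 + w v α) ^ (2 * ∑ j, d j) * E v
  have hc (v : Place K) (hv : v ∈ S) : 0 ≤ c v :=
    mul_nonneg (pow_nonneg (by linarith [(w v).nonneg α]) _) (hE0 v hv)
  have hT (v : Place K) (_ : v ∈ T) : normAbs v (aeval x Q) ≤
      (l1Norm intAbv Q * if v ∈ S then c v else 1) * ∏ j, max 1 (normAbs v (x j)) ^ d j := by
    split_ifs with hv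
    · exact normAbs_aeval_le_of_orderGE (hw v hv) x hd ht (hE0 v hv) (hE v hv)
    · simpa only [mul_one] using normAbs_aeval_le v x hd
  have hTc (v : Place K) (hv : v ∉ T) :
      normAbs v (aeval x Q) ≤ ∏ j, max 1 (normAbs v (x j)) ^ d j := by
    rcases v with v | v
    · simp [T] at hv
    · exact normAbs_inr_aeval_le v x hd
  have hprod := one_le_prod_mul_finprod hx (.prod (hasFiniteMulSupport_max_one_normAbs_pow x d) _)
    hT hTc
  rw [finprod_prod_max_one_normAbs_pow, Finset.prod_mul_distrib, Finset.prod_const,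
    Finset.prod_ite_mem, Finset.union_inter_cancel_left] at hprod
  have hcard : T.card ≤ S.card + Fintype.card (InfinitePlace K) :=
    (Finset.card_union_le _ _).trans (Nat.add_le_add_left Finset.card_image_le _)
  refine hprod.trans (mul_le_mul_of_nonneg_right (mul_le_mul_of_nonneg_right
    (pow_le_pow_right₀ (one_le_l1Norm_intAbv hQ) hcard) (Finset.prod_nonneg hc)) ?_)
  exact Finset.prod_nonneg fun j _ => pow_nonneg (height_pos _).le _

end ProductFormula

section Selection

open Finset in
theorem le_sum_min {ι : Type*} (S : Finset ι) {x : ι → ℝ} (hx : ∀ v ∈ S, 0 ≤ x v) {B : ℝ}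
    (hB : 0 ≤ B) (hsum : B ≤ ∑ v ∈ S, x v) : B ≤ ∑ v ∈ S, min (x v) B := by
  by_cases h : ∀ v ∈ S, x v ≤ B
  · rwa [sum_congr rfl fun v hv => min_eq_left (h v hv)]
  · push Not at h
    obtain ⟨v, hv, hvB⟩ := h
    calc B = min (x v) B := (min_eq_right hvB.le).symm
      _ ≤ _ := single_le_sum (f := fun v => min (x v) B) (fun u hu => le_min (hx u hu) hB) hv

theorem floor_mul_div_le {n : ℕ} (hn : 0 < n) {y : ℝ} (hy : 0 ≤ y) : (⌊n * y⌋₊ : ℝ) / n ≤ y := by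
  rw [div_le_iff₀ (Nat.cast_pos.2 hn), mul_comm y]
  exact Nat.floor_le (by positivity)

theorem le_floor_mul_div_add {n : ℕ} (hn : 0 < n) (y : ℝ) : y ≤ (⌊n * y⌋₊ : ℝ) / n + 1 / n := by
  rw [← add_div, le_div_iff₀ (Nat.cast_pos.2 hn), mul_comm]
  exact (Nat.lt_floor_add_one _).le

theorem exists_common_lower_bound {ι X : Type*} (S : Finset ι) {Y : Set X} (hY : Y.Infinite)
    {x : X → ι → ℝ} (hx : ∀ β ∈ Y, ∀ v ∈ S, 0 ≤ x β v) {B ε : ℝ} (hB : 0 ≤ B) (hε : 0 < ε)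
    (hsum : ∀ β ∈ Y, B + ε ≤ ∑ v ∈ S, x β v) :
    ∃ κ : ι → ℝ, (∀ v ∈ S, 0 ≤ κ v) ∧ B ≤ ∑ v ∈ S, κ v ∧
      {β | β ∈ Y ∧ ∀ v ∈ S, κ v ≤ x β v}.Infinite := by
  -- Truncate the coordinates at `B + ε`, round them down to multiples of `1 / n`, and apply the
  -- pigeonhole principle to the finitely many resulting vectors.
  obtain ⟨n, hn⟩ := exists_nat_gt ((S.card : ℝ) / ε)
  have hn0 : 0 < n := Nat.cast_pos.1 ((by positivity : (0 : ℝ) ≤ S.card / ε).trans_lt hn)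
  rw [div_lt_iff₀ hε] at hn
  let y (β : X) (v : ι) : ℝ := min (x β v) (B + ε)
  let f (β : Y) (v : S) : Fin (⌊n * (B + ε)⌋₊ + 1) := ⟨⌊n * y β v⌋₊, Nat.lt_succ_of_le
    (Nat.floor_le_floor (mul_le_mul_of_nonneg_left (min_le_right _ _) (Nat.cast_nonneg n)))⟩
  have : Infinite Y := hY.to_subtype
  obtain ⟨a, ha⟩ := Finite.exists_infinite_fiber f
  have hfiber : (f ⁻¹' {a}).Infinite := Set.infinite_coe_iff.1 ha
  obtain ⟨β₀, hβ₀⟩ := hfiber.nonempty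
  refine ⟨fun v => ⌊n * y β₀ v⌋₊ / n, fun v _ => by positivity, ?_, ?_⟩
  · have hround : ∑ v ∈ S, y β₀ v ≤ ∑ v ∈ S, ((⌊n * y β₀ v⌋₊ : ℝ) / n + 1 / n) :=
      Finset.sum_le_sum fun v _ => le_floor_mul_div_add hn0 _
    have herror : (S.card : ℝ) * (1 / n) ≤ ε := by
      rw [mul_one_div, div_le_iff₀ (Nat.cast_pos.2 hn0)]
      linarith
    rw [Finset.sum_add_distrib, Finset.sum_const, nsmul_eq_mul] at hround
    linarith [le_sum_min S (hx β₀ β₀.2) (by linarith) (hsum β₀ β₀.2)]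
  · refine (hfiber.image Subtype.val_injective.injOn).mono ?_
    rintro _ ⟨β, hβ, rfl⟩
    refine ⟨β.2, fun v hv => ?_⟩
    have hfloor : ⌊n * y β v⌋₊ = ⌊n * y β₀ v⌋₊ :=
      congrArg Fin.val (congrFun (hβ.trans hβ₀.symm) ⟨v, hv⟩)
    change (⌊n * y β₀ v⌋₊ : ℝ) / n ≤ x β v
    rw [← hfloor]
    exact (floor_mul_div_le hn0 (le_min (hx β β.2 v hv) (by linarith))).trans (min_le_left _ _)

theorem exists_gap_sequence {X : Type*} {h : X → ℝ} (hh : ∀ x, 0 ≤ h x) {Y : Set X}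
    (hY : ∀ T, ∃ x ∈ Y, T ≤ h x) {Λ : ℝ} (hΛ : 0 ≤ Λ) (T : ℝ) (m : ℕ) :
    ∃ β : Fin m → X, (∀ j, β j ∈ Y) ∧ (∀ j, T ≤ h (β j)) ∧
      ∀ i j, i < j → Λ * h (β j) ≤ h (β i) := by
  induction m with
  | zero => exact ⟨Fin.elim0, fun j => j.elim0, fun j => j.elim0, fun j => j.elim0⟩
  | succ m ih =>
    obtain ⟨β, hβY, hβT, hβ⟩ := ih
    obtain ⟨b, hbY, hb⟩ := hY (max T (Λ * ∑ j, h (β j)))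
    refine ⟨Fin.cons b β, fun j => ?_, fun j => ?_, fun i j hij => ?_⟩
    · cases j using Fin.cases <;> simp [hbY, hβY]
    · cases j using Fin.cases
      · simpa using (le_max_left _ _).trans hb
      · simpa using hβT _
    · cases j using Fin.cases with
      | zero => exact absurd hij (Fin.not_lt_zero i)
      | succ j =>
        cases i using Fin.cases with
        | zero =>
          refine le_trans (mul_le_mul_of_nonneg_left ?_ hΛ) ((le_max_right _ _).trans hb)
          exact Finset.single_le_sum (f := fun j => h (β j)) (fun _ _ => hh _) (Finset.mem_univ j)
        | succ i => simpa using hβ i j (Fin.succ_lt_succ_iff.1 hij)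

theorem exists_balanced_degrees {ι : Type*} [Finite ι] [Nonempty ι] {h : ι → ℝ}
    (hh : ∀ j, 0 < h j) {δ : ℝ} (hδ : 0 < δ) :
    ∃ (D : ℝ) (d : ι → ℕ), 0 < D ∧ (∀ j, 0 < d j) ∧
      (∀ j, D ≤ d j * h j) ∧ ∀ j, d j * h j ≤ (1 + δ) * D := by
  cases nonempty_fintype ι
  have hsum : 0 < ∑ j, h j := Finset.sum_pos (fun j _ => hh j) Finset.univ_nonempty
  set D := (∑ j, h j) / δ with hD
  have hD0 : 0 < D := div_pos hsum hδ
  refine ⟨D, fun j => ⌈D / h j⌉₊, hD0, fun j => Nat.ceil_pos.2 (div_pos hD0 (hh j)),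
    fun j => ?_, fun j => ?_⟩
  · rw [← div_le_iff₀ (hh j)]
    exact Nat.le_ceil _
  · have hhj : h j ≤ δ * D := by
      rw [hD, mul_div_cancel₀ _ hδ.ne']
      exact Finset.single_le_sum (fun j _ => (hh j).le) (Finset.mem_univ j)
    calc (⌈D / h j⌉₊ : ℝ) * h j ≤ (D / h j + 1) * h j :=
          mul_le_mul_of_nonneg_right (Nat.ceil_lt_add_one (div_pos hD0 (hh j)).le).le (hh j).le
      _ = D + h j := by rw [add_mul, div_mul_cancel₀ _ (hh j).ne', one_mul]
      _ ≤ _ := by linarith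

theorem exists_balanced_sequence {X : Type*} {h : X → ℝ} (hh : ∀ x, 0 ≤ h x) {Y : Set X}
    (hY : ∀ T, ∃ x ∈ Y, T ≤ h x) {m : ℕ} (hm : 0 < m) {Λ T δ : ℝ} (hΛ : 0 ≤ Λ) (hT : 0 < T)
    (hδ : 0 < δ) (hδ1 : δ ≤ 1) :
    ∃ (x : Fin m → X) (d : Fin m → ℕ) (D : ℝ), (∀ j, x j ∈ Y) ∧ 0 < D ∧ (∀ j, 0 < d j) ∧
      (∀ j, D ≤ d j * h (x j)) ∧ (∀ j, d j * h (x j) ≤ (1 + δ) * D) ∧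
      (∀ i j, i < j → Λ * d i ≤ d j) ∧ T * ∑ j, (d j : ℝ) ≤ D := by
  have : NeZero m := ⟨hm.ne'⟩
  have hm0 : (0 : ℝ) < m := Nat.cast_pos.2 hm
  obtain ⟨x, hxY, hxT, hgap⟩ :=
    exists_gap_sequence hh hY (mul_nonneg zero_le_two hΛ) (2 * m * T) m
  have hx0 (j : Fin m) : 0 < h (x j) := (by positivity : 0 < 2 * m * T).trans_le (hxT j)
  obtain ⟨D, d, hD0, hd0, hDd, hdD⟩ := exists_balanced_degrees hx0 hδ
  have hd2D (j : Fin m) : d j * h (x j) ≤ 2 * D :=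
    (hdD j).trans (mul_le_mul_of_nonneg_right (by linarith) hD0.le)
  refine ⟨x, d, D, hxY, hD0, hd0, hDd, hdD, fun i j hij => ?_, ?_⟩
  · refine le_of_mul_le_mul_right ?_ (hx0 j)
    linarith [mul_le_mul_of_nonneg_left (hgap i j hij) (Nat.cast_nonneg (α := ℝ) (d i)), hd2D i,
      hDd j]
  · have hle (j : Fin m) : m * T * d j ≤ D := by
      linarith [mul_le_mul_of_nonneg_left (hxT j) (Nat.cast_nonneg (α := ℝ) (d j)), hd2D j]
    have hsum : ∑ j, m * T * (d j : ℝ) ≤ m * D := by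
      simpa using Finset.sum_le_sum fun j (_ : j ∈ Finset.univ) => hle j
    rw [← Finset.mul_sum, mul_assoc] at hsum
    exact le_of_mul_le_mul_left hsum hm0

end Selection

section Approximation

variable {K : Type*} [Field K] {L : Type*} [Field L] [Algebra K L] {α : L} {β : K}

theorem min_one_abv_sub_pos (w : AbsoluteValue L ℝ) (hβ : algebraMap K L β ≠ α) :
    0 < min 1 (w (algebraMap K L β - α)) :=
  lt_min one_pos (w.pos (sub_ne_zero.2 hβ))

variable [NumberField K]

/-- The exponent `κ` of the approximation `β` of `α` with respect to `w`, determined by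
`min 1 (w (β - α)) = height β ^ (-κ)` when `β ≠ α` and `1 < height β`. -/
noncomputable def approxExponent (w : AbsoluteValue L ℝ) (α : L) (β : K) : ℝ :=
  -Real.logb (height β) (min 1 (w (algebraMap K L β - α)))

theorem approxExponent_nonneg (w : AbsoluteValue L ℝ) (hβ : 1 < height β) :
    0 ≤ approxExponent w α β :=
  neg_nonneg.2 (Real.logb_nonpos hβ (le_min zero_le_one (w.nonneg _)) (min_le_left _ _))

theorem min_one_abv_sub_le_rpow {w : AbsoluteValue L ℝ} (hβα : algebraMap K L β ≠ α)
    (hβ : 1 < height β) {κ : ℝ} (hκ : κ ≤ approxExponent w α β) :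
    min 1 (w (algebraMap K L β - α)) ≤ height β ^ (-κ) := by
  rw [← Real.logb_le_iff_le_rpow hβ (min_one_abv_sub_pos w hβα)]
  exact le_neg_of_le_neg hκ

theorem lt_sum_approxExponent {S : Finset (Place K)} {w : Place K → AbsoluteValue L ℝ}
    (hβα : algebraMap K L β ≠ α) (hβ : 1 < height β) {κ : ℝ}
    (hprod : ∏ v ∈ S, min 1 (w v (algebraMap K L β - α)) < 1 / height β ^ κ) :
    κ < ∑ v ∈ S, approxExponent (w v) α β := by
  have hpos (v : Place K) := min_one_abv_sub_pos (w v) hβα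
  rw [one_div, ← Real.rpow_neg (height_pos β).le,
    ← Real.logb_lt_iff_lt_rpow hβ (Finset.prod_pos fun v _ => hpos v),
    Real.logb_prod _ _ fun v _ => (hpos v).ne'] at hprod
  simp only [approxExponent, Finset.sum_neg_distrib]
  exact lt_neg_of_lt_neg hprod

theorem exists_exponents (S : Finset (Place K)) (w : Place K → AbsoluteValue L ℝ) (α : L) {ε : ℝ}
    (hε : 0 < ε) (hinf : {β : K | ∏ v ∈ S, min 1 (w v (algebraMap K L β - α))
      < 1 / height β ^ (2 + ε)}.Infinite) :
    ∃ κ : Place K → ℝ, (∀ v ∈ S, 0 ≤ κ v) ∧ 2 + ε / 2 ≤ ∑ v ∈ S, κ v ∧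
      {β : K | ∀ v ∈ S, min 1 (w v (algebraMap K L β - α)) ≤ height β ^ (-κ v)}.Infinite := by
  have hfin : {β : K | algebraMap K L β = α}.Finite := Set.Subsingleton.finite
    fun a ha b hb => (algebraMap K L).injective (ha.trans hb.symm)
  have hY := (hinf.sdiff hfin).sdiff (finite_log_height_le (K := K) 0)
  set Y := ({β : K | _} \ {β : K | _}) \ {β : K | _}
  have hY1 (β : K) (hβ : β ∈ Y) : 1 < height β :=
    (Real.log_pos_iff (height_pos β).le).1 (not_le.1 hβ.2)
  obtain ⟨κ, hκ0, hκ, hκinf⟩ := exists_common_lower_bound S hY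
    (x := fun β v => approxExponent (w v) α β) (B := 2 + ε / 2)
    (fun β hβ v _ => approxExponent_nonneg (w v) (hY1 β hβ)) (by linarith) (half_pos hε)
    fun β hβ => by linarith [lt_sum_approxExponent hβ.1.2 (hY1 β hβ) hβ.1.1]
  exact ⟨κ, hκ0, hκ, hκinf.mono fun β hβ v hv =>
    min_one_abv_sub_le_rpow hβ.1.1.2 (hY1 β hβ.1) (hβ.2 v hv)⟩

end Approximation

section Main

open MvPolynomial NumberField Height

theorem prod_pow_le_exp {σ : Type*} [Fintype σ] {d : σ → ℕ} (hd : ∀ j, 0 < d j) {h l : σ → ℝ}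
    {κ D s : ℝ} (hκ : 0 ≤ κ) (hD : 0 ≤ D) (hDd : ∀ j, D ≤ d j * h j) (hl : ∀ j, 0 ≤ l j)
    (hlh : ∀ j, l j ≤ Real.exp (-(κ * h j))) {e : σ →₀ ℕ} (he : s ≤ indexWeight d e) :
    ∏ j, l j ^ e j ≤ Real.exp (-(κ * (D * s))) := by
  have hDs : D * s ≤ ∑ j, e j * h j := by
    refine (mul_le_mul_of_nonneg_left he hD).trans ?_
    rw [indexWeight_apply, Finset.mul_sum]
    refine Finset.sum_le_sum fun j _ => ?_
    rw [mul_div_assoc', div_le_iff₀ (Nat.cast_pos.2 (hd j))]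
    linarith [mul_le_mul_of_nonneg_left (hDd j) (Nat.cast_nonneg (α := ℝ) (e j))]
  calc ∏ j, l j ^ e j ≤ ∏ j, Real.exp (-(κ * (e j * h j))) := by
        refine Finset.prod_le_prod (fun j _ => pow_nonneg (hl j) _) fun j _ => ?_
        refine (pow_le_pow_left₀ (hl j) (hlh j) _).trans_eq ?_
        rw [← Real.exp_nat_mul]
        ring_nf
    _ = Real.exp (-(κ * ∑ j, e j * h j)) := by
        rw [← Real.exp_sum, Finset.sum_neg_distrib, Finset.mul_sum]
    _ ≤ _ := Real.exp_le_exp.2 (neg_le_neg (mul_le_mul_of_nonneg_left hDs hκ))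

variable {K : Type*} [Field K] [NumberField K] {L : Type*} [Field L] [Algebra K L]

theorem isAlgebraic_int {α : L} (hα : IsAlgebraic K α) : IsAlgebraic ℤ α := by
  have : CharZero L := charZero_of_injective_algebraMap (algebraMap K L).injective
  rw [IsFractionRing.isAlgebraic_iff ℤ ℚ L]
  exact hα.restrictScalars ℚ

theorem sum_exponents_mul_le {σ : Type*} [Fintype σ] (S : Finset (Place K))
    (w : Place K → AbsoluteValue L ℝ) (hw : ∀ v ∈ S, Extends (w v) v) {α : L}
    {κ : Place K → ℝ} (hκ : ∀ v ∈ S, 0 ≤ κ v) {x : σ → K}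
    (hx : ∀ j, ∀ v ∈ S, min 1 (w v (algebraMap K L (x j) - α)) ≤ height (x j) ^ (-κ v))
    {d : σ → ℕ} (hd : ∀ j, 0 < d j) {D : ℝ} (hD : 0 ≤ D)
    (hDd : ∀ j, D ≤ d j * Real.log (height (x j))) {Q : MvPolynomial σ ℤ}
    (hdeg : ∀ j, degreeOf j Q ≤ d j) (hQ : aeval x Q ≠ 0) {s : ℝ}
    (hs : OrderGE (indexWeight d) s (taylor (fun _ => α) Q)) :
    (∑ v ∈ S, κ v) * (D * s) ≤
      (S.card + Fintype.card (InfinitePlace K)) * Real.log (l1Norm intAbv Q) +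
      (∑ v ∈ S, 2 * Real.log (1 + w v α)) * (∑ j, (d j : ℝ)) +
      ∑ j, d j * Real.log (height (x j)) := by
  have hexp (j : σ) (v : Place K) (hv : v ∈ S) : min 1 (w v (algebraMap K L (x j) - α)) ≤
      Real.exp (-(κ v * Real.log (height (x j)))) := by
    refine (hx j v hv).trans_eq ?_
    rw [Real.rpow_def_of_pos (height_pos _), mul_neg, mul_comm]
  have hone := one_le_of_aeval_ne_zero S w hw hdeg hQ hs
    (E := fun v => Real.exp (-(κ v * (D * s)))) (fun v _ => (Real.exp_pos _).le)
    fun v hv e he => prod_pow_le_exp hd (hκ v hv) hD hDd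
      (fun j => le_min zero_le_one ((w v).nonneg _)) (fun j => hexp j v hv) he
  have hQ0 : Q ≠ 0 := fun h => hQ (by rw [h, map_zero])
  have hl : l1Norm intAbv Q ≠ 0 := (one_pos.trans_le (one_le_l1Norm_intAbv hQ0)).ne'
  have hA (v : Place K) : 1 + w v α ≠ 0 := by linarith [(w v).nonneg α]
  have hlog := Real.log_nonneg hone
  rw [Real.log_mul, Real.log_mul, Real.log_pow, Real.log_prod, Real.log_prod,
    Finset.sum_congr rfl fun v _ => Real.log_mul (pow_ne_zero _ (hA v)) (Real.exp_ne_zero _),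
    Finset.sum_add_distrib] at hlog
  · simp only [Real.log_pow, Real.log_exp, Finset.sum_neg_distrib, ← Finset.sum_mul] at hlog
    rw [← Finset.mul_sum] at hlog ⊢
    push_cast at hlog
    linarith
  all_goals simp [Finset.prod_ne_zero_iff, hl, hA, (height_pos _).ne', Real.exp_ne_zero]

theorem exists_polynomial_orderGE_aeval_ne_zero {α : L} (hα : IsAlgebraic K α) {δ : ℝ}
    (hδ : 0 < δ) (hδ1 : δ < 1 / 2) :
    ∃ (m : ℕ) (C Λ T : ℝ), 0 < m ∧ 0 ≤ C ∧ 0 ≤ Λ ∧ 0 < T ∧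
      ∀ (x : Fin m → K) (d : Fin m → ℕ), (∀ j, 0 < d j) → (∀ i j, i < j → Λ * d i ≤ d j) →
        (∀ j, T * ∑ i, (d i : ℝ) ≤ d j * Real.log (height (x j))) →
        ∃ Q : MvPolynomial (Fin m) ℤ, (∀ j, degreeOf j Q ≤ d j) ∧ aeval x Q ≠ 0 ∧
          OrderGE (indexWeight d) (m * (1 / 2 - 2 * δ)) (taylor (fun _ => α) Q) ∧
          Real.log (l1Norm intAbv Q) ≤ C * ∑ j, (d j : ℝ) := by
  have : CharZero L := charZero_of_injective_algebraMap (algebraMap K L).injective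
  obtain ⟨m, B, hm, hB, haux⟩ := exists_auxiliary_polynomial (isAlgebraic_int hα) hδ hδ1
  obtain ⟨Λ, hΛ, hindex⟩ := exists_indexBound (K := K) m hδ
  have hlogB : 0 ≤ Real.log B := Real.log_nonneg hB
  refine ⟨m, Real.log (2 * B), Λ, Λ * (Real.log B + 1), hm, Real.log_nonneg (by linarith),
    by linarith, by positivity, fun x d hd hgap hT => ?_⟩
  obtain ⟨P, hP, hPdeg, hPnorm, hPα⟩ := haux d hd
  have hlogP : Real.log (l1Norm intAbv P) ≤ Real.log B * ∑ j, (d j : ℝ) := by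
    have := Real.log_le_log (one_pos.trans_le (one_le_l1Norm_intAbv hP)) hPnorm
    rwa [Real.log_pow, Nat.cast_sum, mul_comm] at this
  have hheight (j : Fin m) :
      Λ * (Real.log (l1Norm intAbv P) + ∑ i, (d i : ℝ)) ≤ d j * logHeight₁ (x j) :=
    calc Λ * (Real.log (l1Norm intAbv P) + ∑ i, (d i : ℝ))
        ≤ Λ * (Real.log B * ∑ i, (d i : ℝ) + ∑ i, (d i : ℝ)) := by gcongr
      _ = Λ * (Real.log B + 1) * ∑ i, (d i : ℝ) := by ring
      _ ≤ d j * Real.log (height (x j)) := hT j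
      _ ≤ d j * logHeight₁ (x j) := by gcongr; exact log_height_le_logHeight₁ _
  obtain ⟨e, he, heδ⟩ := hindex d x P hd hgap hP hPdeg hheight
  have hQx : aeval x (hasseDeriv e P) ≠ 0 := by rwa [aeval_hasseDeriv]
  have hQ : hasseDeriv e P ≠ 0 := fun h => hQx (by rw [h, map_zero])
  refine ⟨hasseDeriv e P, fun j => (degreeOf_hasseDeriv_le P e j).trans (hPdeg j), hQx, ?_, ?_⟩
  · rw [← hasseDeriv_taylor]
    refine (hPα.hasseDeriv e).mono ?_
    linarith [mul_le_mul_of_nonneg_right (Nat.one_le_cast (α := ℝ).2 hm) hδ.le]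
  · have hnorm : l1Norm intAbv (hasseDeriv e P) ≤ (2 * B) ^ ∑ j, d j := by
      rw [mul_pow]
      exact (l1Norm_hasseDeriv_le intAbv hPdeg e).trans
        (mul_le_mul_of_nonneg_left hPnorm (by positivity))
    have := Real.log_le_log (one_pos.trans_le (one_le_l1Norm_intAbv hQ)) hnorm
    rwa [Real.log_pow, Nat.cast_sum, mul_comm] at this

theorem finite_of_two_lt_sum_exponents (S : Finset (Place K))
    (w : Place K → AbsoluteValue L ℝ) (hw : ∀ v ∈ S, Extends (w v) v) {α : L}
    (hα : IsAlgebraic K α) {κ : Place K → ℝ} (hκ : ∀ v ∈ S, 0 ≤ κ v) {ε : ℝ} (hε : 0 < ε)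
    (hε1 : ε ≤ 1) (hsum : 2 + ε ≤ ∑ v ∈ S, κ v) :
    {β : K | ∀ v ∈ S, min 1 (w v (algebraMap K L β - α)) ≤ height β ^ (-κ v)}.Finite := by
  by_contra hinf
  obtain ⟨m, C, Λ, T, hm, hC, hΛ, hT, hpoly⟩ :=
    exists_polynomial_orderGE_aeval_ne_zero hα (δ := ε / 40) (by linarith) (by linarith)
  set τ : ℝ := S.card + Fintype.card (InfinitePlace K)
  set A := ∑ v ∈ S, 2 * Real.log (1 + w v α)
  have hA : 0 ≤ A := Finset.sum_nonneg fun v _ =>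
    mul_nonneg zero_le_two (Real.log_nonneg (by linarith [(w v).nonneg α]))
  obtain ⟨x, d, D, hxY, hD, hd, hDd, hdD, hgap, hdsum⟩ :=
    exists_balanced_sequence log_height_nonneg (exists_le_log_height hinf) hm hΛ
      (by positivity : 0 < T + 5 * (τ * C + A) / ε) (by linarith : 0 < ε / 40) (by linarith)
  have hd0 : 0 ≤ ∑ j, (d j : ℝ) := Finset.sum_nonneg fun _ _ => Nat.cast_nonneg _
  rw [add_mul] at hdsum
  obtain ⟨Q, hQdeg, hQx, hQα, hQnorm⟩ := hpoly x d hd hgap fun j => by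
    have : 0 ≤ 5 * (τ * C + A) / ε * ∑ j, (d j : ℝ) := by positivity
    linarith [hDd j]
  have hupper := sum_exponents_mul_le S w hw hκ hxY hd hD.le hDd hQdeg hQx hQα
  have hheights : ∑ j, d j * Real.log (height (x j)) ≤ m * ((1 + ε / 40) * D) := by
    simpa using Finset.sum_le_sum fun j (_ : j ∈ Finset.univ) => hdD j
  have hmD : D ≤ m * D := le_mul_of_one_le_left hD.le (Nat.one_le_cast.2 hm)
  have herror : τ * Real.log (l1Norm intAbv Q) + A * ∑ j, (d j : ℝ) ≤ ε / 5 * (m * D) :=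
    calc τ * Real.log (l1Norm intAbv Q) + A * ∑ j, (d j : ℝ)
        ≤ τ * (C * ∑ j, (d j : ℝ)) + A * ∑ j, (d j : ℝ) := by gcongr
      _ = ε / 5 * (5 * (τ * C + A) / ε * ∑ j, (d j : ℝ)) := by field_simp
      _ ≤ ε / 5 * D := by gcongr; linarith [mul_nonneg hT.le hd0]
      _ ≤ ε / 5 * (m * D) := by gcongr
  have hlower : (2 + ε) * (D * (m * (1 / 2 - 2 * (ε / 40)))) ≤
      (∑ v ∈ S, κ v) * (D * (m * (1 / 2 - 2 * (ε / 40)))) :=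
    mul_le_mul_of_nonneg_right hsum
      (mul_nonneg hD.le (mul_nonneg (Nat.cast_nonneg m) (by linarith)))
  have hratio : (2 + ε) * (1 / 2 - 2 * (ε / 40)) ≤ ε / 5 + (1 + ε / 40) :=
    le_of_mul_le_mul_right (by linarith) (hD.trans_le hmD)
  nlinarith

end Main

end Roth

theorem mainTheorem1_general {K L : Type*} [Field K] [NumberField K] [Field L] [Algebra K L]
    (S : Finset (Roth.Place K)) (w : Roth.Place K → AbsoluteValue L ℝ)
    (hw : ∀ v ∈ S, Roth.Extends (w v) v) {α : L} (hα : IsAlgebraic K α) {ε : ℝ} (hε : 0 < ε) :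
    {β : K | ∏ v ∈ S, min 1 (w v (algebraMap K L β - α)) < 1 / Roth.height β ^ (2 + ε)}.Finite := by
  by_contra hinf
  obtain ⟨κ, hκ, hsum, hκinf⟩ := Roth.exists_exponents S w α hε hinf
  have hgap : 2 + min (ε / 2) 1 ≤ ∑ v ∈ S, κ v := by linarith [min_le_left (ε / 2) 1]
  exact hκinf (Roth.finite_of_two_lt_sum_exponents S w hw hα hκ
    (lt_min (half_pos hε) one_pos) (min_le_right _ _) hgap)

theorem mainTheorem1 (K : Type*) [Field K] [NumberField K]
    (S : Finset (Roth.Place K))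
    (w : Roth.Place K → AbsoluteValue (AlgebraicClosure K) ℝ)
    (hw : ∀ v ∈ S, Roth.Extends (w v) v)
    (α : AlgebraicClosure K) (ε : ℝ) (hε : 0 < ε) :
    {β : K | ∏ v ∈ S, min 1 (w v (algebraMap K (AlgebraicClosure K) β - α))
      < 1 / Roth.height β ^ (2 + ε)}.Finite :=
  mainTheorem1_general S w hw (Algebra.IsAlgebraic.isAlgebraic α) hε
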